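/- **Setting.** A plant $\dot x_p=f_p(x_p,\hat u,w)$ and a controller $\dot x_c=f_c(x_c,\hat x_p)$, $u=g_c(x_c,x_p)$, are sampled at instants $t_j$ with zero-order hold. Put $x=(x_p,x_c)\in\mathbb R^{n_x}$, let $\hat x$ be the last sampled value of $x$, let $e=\hat x-x$, and let $$f(x,e,w)=\begin{pmatrix} f_p(x_p,\,g_c(x_c+e_{x_c},\,x_p+e_{x_p}),\,w)\\ f_c(x_c,\,x_p+e_{x_p})\end{pmatrix},$$ which is assumed continuous. For maps $S$ and $\Gamma$, the hybrid system $\mathcal H_{STC}$ has state $\xi=(x,e,\eta,\tau,\tau_{\max})$. It flows with $\dot\xi=(f(x,e,w),-f(x,e,w),0,1,0)$ while $\tau\le\tau_{\max}$ and jumps when $\tau=\tau_{\max}$, with $\xi^+=(x,0,S(\eta,x),0,\Gamma(x,\eta))$. Solutions are absolutely continuous hybrid arcs on hybrid time domains, for locally integrable inputs $w$. Jump times are the sampling instants: $t_j$ is the time of the jump from $j$ to $j+1$. Initial conditions satisfy $\tau_{\max}(0,0)=\tau(0,0)\ge0$, so $t_0=0$. **Disturbances and constants.** Let $\bar w>0$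 and $\mathcal W=\{w:|w|\le\bar w\}$. Let $m>1$ (with $\eta\in\mathbb R^{m-1}$), $\epsilon_{\rm ref}>0$ and $\delta\in(0,1)$. Write $\mathcal X_c=\{x:V(x)\le c\}$. **Local assumption for $(c,\epsilon,\gamma,L)$**, with given $V$ and $\alpha_w$: $c,\gamma,L>0$; $\alpha_w\in\mathcal K_\infty$; $V:\mathbb R^{n_x}\to\mathbb R_{\ge0}$ is locally Lipschitz and bounded below and above by $\mathcal K_\infty$ functions of $|x|$; and there are a locally Lipschitz $W:\mathbb R^{n_x}\to\mathbb R_{\ge0}$, bounded below and above by $\mathcal K_\infty$ functions of $|e|$, and a continuous $H:\mathbb R^{n_x}\times\mathbb R^{n_x}\times\mathcal W\to\mathbb R_{\ge0}$ such that * for all $x\in\mathcal X_c$, $w\in\mathcal W$ and almost all $e$ with $x+e\in\mathcal X_c$: $\langle\nabla W(e),-f(x,e,w)\rangle\le LW(e)+H(x,e,w)$; * for all $e$, all $w\in\mathcal W$ and almost all $x$ with $x,\,x+e\in\mathcal X_c$: $\langle\nabla V(x),f(x,e,w)\rangle\le-\epsilon V(x)-H^2(x,e,w)+\gamma^2W^2(e)+\alpha_w(|w|)$.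 **Hypotheses.** For levels $c_l$, $l=1,\dots,n_c$, and parameter sets $\epsilon_{i,l},\gamma_{i,l},L_{i,l}$, $i=1,\dots,n_{\rm par}$, the local assumption holds for every $(c_l,\epsilon_{i,l},\gamma_{i,l},L_{i,l})$ with the same $V$ and $\alpha_w$. Moreover $\epsilon_{1,l}>0$, and $\epsilon_{i,l}<0$ for $i>1$. Let $\max_l c_l\ge c_{\max}\ge c_w\ge\max_l\alpha_w(\bar w)/\epsilon_{1,l}$. For every $l$ with $c_w\le c_l\le c_{\max}$ assume the nondegeneracy conditions $c_l>\alpha_w(\bar w)/\epsilon_{1,l}$ and that every point of $\{V=c_l\}$ is a limit of points of $\{V<c_l\}$. **Mechanism.** Let $$C(x,\eta)=\max\Big\{\min\Big\{\tfrac1m\Big(V(x)+\sum_{k=1}^{m-1}\eta_k\Big),c_{\max}\Big\},c_w\Big\},$$ $$S(\eta,x)=e^{-\epsilon_{\rm ref}\Gamma(x,\eta)}(\eta_2,\dots,\eta_{m-1},V(x))^\top.$$ With $r=\sqrt{|(\gamma/\Lambda)^2-1|}$, let $T_{\max}(\gamma,\Lambda)$ be $\frac1{\Lambda r}\arctan r$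 if $\gamma>\Lambda$, $\frac1\Lambda$ if $\gamma=\Lambda$, and $\frac1{\Lambda r}\operatorname{arctanh} r$ if $\gamma<\Lambda$. The value $\Gamma(x,\eta)$ is computed as follows. With $V=V(x)$ and $C=C(x,\eta)$, take the smallest index $l$ with $c_l\ge\max\{V,C\}$; then $$\Gamma(x,\eta)=\max\Big\{\delta T_{\max}\big(\gamma_{1,l},L_{1,l}+\tfrac{\epsilon_{1,l}}2\big),\ \bar h_2,\dots,\bar h_{n_{\rm par}}\Big\}.$$ Here $\bar h_i=0$ if $C<V$; otherwise, with $\Lambda_i=\max\{L_{i,l}+\frac{\epsilon_{i,l}}2,1-\delta\}$, $$\bar h_i=\min\Big\{\delta T_{\max}(\gamma_{i,l},\Lambda_i),\ \frac{\log(C-\alpha_w(\bar w)/\epsilon_{i,l})-\log(V-\alpha_w(\bar w)/\epsilon_{i,l})}{-\epsilon_{i,l}+\epsilon_{\rm ref}}\Big\}.$$ **Conclusion.** Let $t_{\min}=\min_l\delta T_{\max}(\gamma_{1,l},L_{1,l}+\epsilon_{1,l}/2)$. Then $t_{\min}>0$, and every solution of $\mathcal H_{STC}$ with $w(t)\in\mathcal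 W$ for all $t\ge0$ and $x(0,0)\in\mathcal X_{c_{\max}}$ satisfies $t_{j+1}-t_j\ge t_{\min}$ for all its consecutive sampling instants. Moreover $\{V\le c_w\}$ is robustly asymptotically stable with region of attraction $\mathcal X_{c_{\max}}$: there is $\beta\in\mathcal{KLL}$ such that for every such solution (with arbitrary $e(0,0)$, $\eta(0,0)$ and $\tau_{\max}(0,0)=\tau(0,0)\ge0$) and all $(t,j)$ in its domain, $$V(x(t,j))\le c_w+\beta\left(\max\{V(x(0,0))-c_w,0\}+\left|\begin{pmatrix}e(0,0)\\ \eta(0,0)\end{pmatrix}\right|,\,t,\,j\right).$$ -/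

import Mathlib

open MeasureTheory Filter Topology Set

noncomputable section

/-! ### Comparison functions (as functions of nonnegative real arguments) -/

/-- Class `K`: continuous, strictly increasing on `[0, ∞)`, zero at zero. -/
def ClassK (α : ℝ → ℝ) : Prop :=
  ContinuousOn α (Ici 0) ∧ StrictMonoOn α (Ici 0) ∧ α 0 = 0

/-- Class `K∞`: class `K` and unbounded. -/
def ClassKInfty (α : ℝ → ℝ) : Prop :=
  ClassK α ∧ ∀ M : ℝ, ∃ s : ℝ, 0 ≤ s ∧ M < α s

/-- Class `KL`. -/
def ClassKL (β : ℝ → ℝ → ℝ) : Prop :=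
  ContinuousOn (fun p : ℝ × ℝ => β p.1 p.2) (Ici 0 ×ˢ Ici 0) ∧
  (∀ t, 0 ≤ t → ClassK (fun q => β q t)) ∧
  ∀ q, 0 ≤ q → AntitoneOn (fun t => β q t) (Ici 0) ∧ Tendsto (fun t => β q t) atTop (𝓝 0)

/-- Class `KLL`. -/
def ClassKLL (β : ℝ → ℝ → ℝ → ℝ) : Prop :=
  ∀ r, 0 ≤ r → ClassKL (fun q s => β q r s) ∧ ClassKL (fun q s => β q s r)

/-! ### Hybrid systems and their solutions -/

/-- Compact hybrid time domain: a finite union of the sets `[t_j, t_{j+1}] × {j}`, `j < J`. -/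
def IsCompactHybridTimeDomain (D : Set (ℝ × ℕ)) : Prop :=
  ∃ (J : ℕ) (t : ℕ → ℝ), t 0 = 0 ∧ (∀ j, j < J → t j ≤ t (j + 1)) ∧
    D = {p : ℝ × ℕ | p.2 < J ∧ t p.2 ≤ p.1 ∧ p.1 ≤ t (p.2 + 1)}

/-- Hybrid time domain. -/
def IsHybridTimeDomain (D : Set (ℝ × ℕ)) : Prop :=
  (∀ p ∈ D, 0 ≤ p.1) ∧
  ∀ p ∈ D, IsCompactHybridTimeDomain (D ∩ {q : ℝ × ℕ | 0 ≤ q.1 ∧ q.1 ≤ p.1 ∧ q.2 ≤ p.2})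

/-- The data `(F, G, C, D)` of a hybrid system with state space `E` and input space `I`. -/
structure HybridSystem (E I : Type*) where
  /-- flow map -/
  F : E → I → E
  /-- jump map -/
  G : E → E
  /-- flow set -/
  C : Set E
  /-- jump set -/
  D : Set E

/-- Hybrid trajectory `ξ` on the domain `dom`: on each `{t | (t, j) ∈ dom}` it is absolutely
continuous in `t` (on every compact subinterval). The values of `ξ` off `dom` are irrelevant. -/
def IsHybridTrajectory {E : Type*} [NormedAddCommGroup E]
    (dom : Set (ℝ × ℕ)) (ξ : ℝ → ℕ → E) : Prop :=
  IsHybridTimeDomain dom ∧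
  ∀ (j : ℕ) (a b : ℝ), a ≤ b → (a, j) ∈ dom → (b, j) ∈ dom →
    AbsolutelyContinuousOnInterval (fun t => ξ t j) a b

/-- `(dom, ξ)` is a solution of the hybrid system `H` for the locally integrable input `w`. -/
def HybridSystem.IsSolution {E I : Type*} [NormedAddCommGroup E] [NormedSpace ℝ E]
    [NormedAddCommGroup I] (H : HybridSystem E I) (w : ℝ → I)
    (dom : Set (ℝ × ℕ)) (ξ : ℝ → ℕ → E) : Prop :=
  LocallyIntegrableOn w (Ici 0) ∧
  IsHybridTrajectory dom ξ ∧
  (∀ j : ℕ, ∀ᵐ t : ℝ, (t, j) ∈ dom →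
    ξ t j ∈ H.C ∧ HasDerivAt (fun s => ξ s j) (H.F (ξ t j) (w t)) t) ∧
  (∀ (t : ℝ) (j : ℕ), (t, j) ∈ dom → (t, j + 1) ∈ dom →
    ξ t j ∈ H.D ∧ ξ t (j + 1) = H.G (ξ t j))

/-! ### The networked control system -/

/-- Euclidean space `ℝⁿ`. -/
abbrev Vec (n : ℕ) := EuclideanSpace ℝ (Fin n)

/-- Combined plant and controller vectors `[x_p; x_c]`, with the Euclidean norm. -/
abbrev PCVec (np nc : ℕ) := EuclideanSpace ℝ (Fin np ⊕ Fin nc)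

/-- Plant component. -/
def plantPart {np nc : ℕ} (x : PCVec np nc) : Vec np := WithLp.toLp 2 (fun i => x (Sum.inl i))

/-- Controller component. -/
def ctrlPart {np nc : ℕ} (x : PCVec np nc) : Vec nc := WithLp.toLp 2 (fun i => x (Sum.inr i))

/-- Stacking of a plant and a controller vector. -/
def stackPC {np nc : ℕ} (a : Vec np) (b : Vec nc) : PCVec np nc :=
  WithLp.toLp 2 (Sum.elim (fun i => a i) (fun i => b i))

/-- The closed-loop vector field `f(x, e, w)` for the plant `ẋ_p = f_p(x_p, û, w)` and the
controller `ẋ_c = f_c(x_c, x̂_p)`, `u = g_c(x_c, x_p)`, where `x + e = x̂` is the sampled state. -/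
def closedLoop {np nc nu nw : ℕ} (fp : Vec np → Vec nu → Vec nw → Vec np)
    (fc : Vec nc → Vec np → Vec nc) (gc : Vec nc → Vec np → Vec nu)
    (x e : PCVec np nc) (w : Vec nw) : PCVec np nc :=
  stackPC
    (fp (plantPart x) (gc (ctrlPart x + ctrlPart e) (plantPart x + plantPart e)) w)
    (fc (ctrlPart x) (plantPart x + plantPart e))

/-- The state `ξ = (x, e, η, τ, τ_max)` of the self-triggered closed loop. -/
abbrev STCState (np nc nη : ℕ) := PCVec np nc × PCVec np nc × Vec nη × ℝ × ℝ

namespace STCState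

variable {np nc nη : ℕ}

/-- plant and controller state -/
def x (ξ : STCState np nc nη) : PCVec np nc := ξ.1
/-- sampling-induced error -/
def e (ξ : STCState np nc nη) : PCVec np nc := ξ.2.1
/-- dynamic variable -/
def η (ξ : STCState np nc nη) : Vec nη := ξ.2.2.1
/-- timer -/
def τ (ξ : STCState np nc nη) : ℝ := ξ.2.2.2.1
/-- next sampling interval -/
def τmax (ξ : STCState np nc nη) : ℝ := ξ.2.2.2.2

end STCState

/-- The hybrid system `H_STC` for the closed-loop vector field `f` (the error dynamics are
`g = -f`), the update `S` of the dynamic variable and the sampling-interval map `Γ`. -/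
def stcSystem {np nc nη nw : ℕ} (f : PCVec np nc → PCVec np nc → Vec nw → PCVec np nc)
    (S : Vec nη → PCVec np nc → Vec nη) (Γ : PCVec np nc → Vec nη → ℝ) :
    HybridSystem (STCState np nc nη) (Vec nw) where
  F := fun ξ w => (f ξ.x ξ.e w, -(f ξ.x ξ.e w), 0, 1, 0)
  G := fun ξ => (ξ.x, 0, S ξ.η ξ.x, 0, Γ ξ.x ξ.η)
  C := {ξ | ξ.τ ≤ ξ.τmax}
  D := {ξ | ξ.τ = ξ.τmax}

/-- Admissible initial conditions for the region of attraction `{V ≤ c}`: arbitrary `e` and `η`,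
and `τ_max = τ ≥ 0`, so that the mechanism is executed at time `0`. -/
def IsAdmissibleInit {np nc nη : ℕ} (V : PCVec np nc → ℝ) (c : ℝ)
    (ξ₀ : STCState np nc nη) : Prop :=
  V ξ₀.x ≤ c ∧ 0 ≤ ξ₀.τ ∧ ξ₀.τmax = ξ₀.τ

/-- Robust asymptotic stability of `{V ≤ c_w}` with region of attraction `{V ≤ c_max}`, for all
disturbances with `|w(t)| ≤ wbar`. -/
def IsRAS {np nc nη nw : ℕ} (H : HybridSystem (STCState np nc nη) (Vec nw)) (wbar : ℝ)
    (V : PCVec np nc → ℝ) (cw cmax : ℝ) : Prop :=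
  ∃ β : ℝ → ℝ → ℝ → ℝ, ClassKLL β ∧
    ∀ (w : ℝ → Vec nw) (dom : Set (ℝ × ℕ)) (ξ : ℝ → ℕ → STCState np nc nη),
      (∀ t, 0 ≤ t → ‖w t‖ ≤ wbar) → H.IsSolution w dom ξ →
      IsAdmissibleInit V cmax (ξ 0 0) →
      ∀ (t : ℝ) (j : ℕ), (t, j) ∈ dom →
        V (ξ t j).x ≤ cw +
          β (max (V (ξ 0 0).x - cw) 0 + √(‖(ξ 0 0).e‖ ^ 2 + ‖(ξ 0 0).η‖ ^ 2)) t j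

/-- The time between any two consecutive sampling instants (jump times) of the hybrid time domain
`dom` is at least `T`. -/
def InterSamplingAtLeast (dom : Set (ℝ × ℕ)) (T : ℝ) : Prop :=
  ∀ (j : ℕ) (t t' : ℝ), (t, j) ∈ dom → (t, j + 1) ∈ dom → (t', j + 1) ∈ dom → (t', j + 2) ∈ dom →
    T ≤ t' - t

/-! ### The local hybrid Lyapunov condition -/

/-- The local hybrid Lyapunov condition on the sublevel set `{V ≤ c}` for disturbances
`|w| ≤ wbar`, with the functions `V`, `αw` and the parameters `ε`, `γ`, `L`. -/
def LocalHybridLyapunov {np nc nw : ℕ} (f : PCVec np nc → PCVec np nc → Vec nw → PCVec np nc)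
    (wbar : ℝ) (V : PCVec np nc → ℝ) (αw : ℝ → ℝ) (c ε γ L : ℝ) : Prop :=
  0 < c ∧ 0 < γ ∧ 0 < L ∧ ClassKInfty αw ∧ LocallyLipschitz V ∧ (∀ x, 0 ≤ V x) ∧
  (∃ α₁ α₂ : ℝ → ℝ, ClassKInfty α₁ ∧ ClassKInfty α₂ ∧ ∀ x, α₁ ‖x‖ ≤ V x ∧ V x ≤ α₂ ‖x‖) ∧
  ∃ (W : PCVec np nc → ℝ) (H : PCVec np nc → PCVec np nc → Vec nw → ℝ),
    LocallyLipschitz W ∧ (∀ e, 0 ≤ W e) ∧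
    (∃ α₁ α₂ : ℝ → ℝ, ClassKInfty α₁ ∧ ClassKInfty α₂ ∧ ∀ e, α₁ ‖e‖ ≤ W e ∧ W e ≤ α₂ ‖e‖) ∧
    ContinuousOn (fun p : PCVec np nc × PCVec np nc × Vec nw => H p.1 p.2.1 p.2.2)
      {p | ‖p.2.2‖ ≤ wbar} ∧
    (∀ x e w, ‖w‖ ≤ wbar → 0 ≤ H x e w) ∧
    (∀ x w, V x ≤ c → ‖w‖ ≤ wbar → ∀ᵐ e, V (x + e) ≤ c →
      inner ℝ (gradient W e) (-(f x e w)) ≤ L * W e + H x e w) ∧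
    (∀ e w, ‖w‖ ≤ wbar → ∀ᵐ x, V x ≤ c → V (x + e) ≤ c →
      inner ℝ (gradient V x) (f x e w) ≤
        -ε * V x - H x e w ^ 2 + γ ^ 2 * W e ^ 2 + αw ‖w‖)

/-! ### The sampling mechanism -/

/-- The bound `T_max(γ, Λ)` on the sampling interval. -/
def Tmax (γ Λ : ℝ) : ℝ :=
  let r := √|(γ / Λ) ^ 2 - 1|
  if Λ < γ then 1 / (Λ * r) * Real.arctan r
  else if γ = Λ then 1 / Λ
  else 1 / (Λ * r) * Real.artanh r

/-- The fall-back sampling interval `δ T_max(γ_1, L_1 + ε_1 / 2)`. -/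
def fallbackInterval (δ ε₁ γ₁ L₁ : ℝ) : ℝ := δ * Tmax γ₁ (L₁ + ε₁ / 2)

/-- The candidate interval for the parameters `ε`, `γ`, `L`, where `v` and `C` are
the values of `V(x)` and `C(x, η)`, and `a` is the value `α_w(wbar)`. -/
def candidateInterval (δ εref a ε γ L v C : ℝ) : ℝ :=
  let Λ := max (L + ε / 2) (1 - δ)
  if v ≤ C then
    if 0 < -ε + εref then
      min (δ * Tmax γ Λ) ((Real.log (C - a / ε) - Real.log (v - a / ε)) / (-ε + εref))
    else δ * Tmax γ Λ
  else 0

open scoped Classical in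
/-- The sampling interval computed by the algorithm from the values `v` of `V(x)` and `C` of
`C(x, η)`: the smallest index `l` with `max(v, C) ≤ c_l` is selected, and the loop over the
parameter sets starts from the fall-back interval. The parameter sets of each level are indexed by
`0, ..., p`, index `0` being the fall-back one. If there is no admissible `l`, the algorithm is not
defined; the value is then set to `0`. -/
def algorithmInterval {n p : ℕ} (δ εref a : ℝ) (c : Fin n → ℝ) (ε γ L : Fin n → Fin (p + 1) → ℝ)
    (v C : ℝ) : ℝ :=
  if h : (Finset.univ.filter (fun l : Fin n => max v C ≤ c l)).Nonempty then
    let l := (Finset.univ.filter (fun l : Fin n => max v C ≤ c l)).min' h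
    (List.finRange p).foldl
      (fun hbar i =>
        let hi := candidateInterval δ εref a (ε l i.succ) (γ l i.succ) (L l i.succ) v C
        if hbar < hi then hi else hbar)
      (fallbackInterval δ (ε l 0) (γ l 0) (L l 0))
  else 0

/-- The clipped average `C(x, η) = max {min {(V(x) + ∑ η_k) / m, c_max}, c_w}`. -/
def firC {np nc : ℕ} (m : ℕ) (V : PCVec np nc → ℝ) (cw cmax : ℝ)
    (x : PCVec np nc) (η : Vec (m - 1)) : ℝ :=
  max (min (1 / (m : ℝ) * (V x + ∑ k, η k)) cmax) cw

/-- The FIR update of the dynamic variable: the entries are shifted by one place, `V(x)` is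
appended, and everything is discounted by `exp (-ε_ref Γ(x, η))`. -/
def firS {np nc : ℕ} (m : ℕ) (V : PCVec np nc → ℝ) (εref : ℝ)
    (Γ : PCVec np nc → Vec (m - 1) → ℝ) (η : Vec (m - 1)) (x : PCVec np nc) : Vec (m - 1) :=
  WithLp.toLp 2 (fun k : Fin (m - 1) =>
    Real.exp (-εref * Γ x η) *
      (if h : (k : ℕ) + 1 < m - 1 then η ⟨(k : ℕ) + 1, h⟩ else V x))

end

/-! ### Absolutely continuous functions -/

/-! Right after a sample `e = 0`. Along the following flow the function `U = V(x) + γ φ W(e)²` is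
used, where `φ ≥ 0` solves the Riccati equation `φ' = -2Λφ - γ(φ² + 1)`; such a `φ` exists on every
interval shorter than `Tmax γ Λ`. If `Λ ≥ L + ε/2`, the cross terms complete a square and `U' ≤ -εU
+ α_w(wbar)`. Since `U = V` at the sample and `V ≤ U` later, `V` obeys the scalar comparison bound
with rate `ε` (`LocalHybridLyapunov.flow_bound`).

Two obstacles make this local estimate delicate. The gradient inequalities hold only almost
everywhere, and a trajectory may run inside the exceptional null set; Fubini along lines and
Lipschitz continuity turn them into bounds on derivatives along curves
(`hasDerivAt_comp_le_add_mul_norm_sub`). They also hold only on `{V ≤ c}`, and the sample may lie on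
its boundary. The trajectory is therefore translated by a small `p` so that it starts in `{V < c}`;
the resulting error in the vector field is absorbed by a constant `κ`, a first-exit argument keeps
the translate inside, and finally `p` and `κ` tend to `0`.

For the fall-back parameters (`ε > 0`) the bound contracts `V - cw` at rate `ε`. For the others (`ε
< 0`) `V` may grow, but the logarithmic constraint on the interval is exactly what gives `V ≤
exp(-εref s) C`. Hence `sampling_interval_decay`: if `V - cw` and `C - cw` are at most `Q` at a
sample, then `V - cw` is at most `exp(-μ s) Q` after time `s`, where `μ` is below `εref` and all
fall-back rates. As `C` is a clipped average of `V` and the `η_k`, and the `η_k` are discounted at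
rate `εref`, one number `Q` bounds all of them and decays like `exp(-μ t)` by induction on the
jumps. Every interval is at least `tmin`, so decay in `t` also gives decay in `j`. -/

lemma AbsolutelyContinuousOnInterval.lipschitzOnWith_comp {X Y : Type*} [PseudoMetricSpace X]
    [PseudoMetricSpace Y] {f : ℝ → X} {g : X → Y} {s : Set X} {a b : ℝ} {K : NNReal}
    (hf : AbsolutelyContinuousOnInterval f a b) (hg : LipschitzOnWith K g s)
    (hs : MapsTo f (uIcc a b) s) :
    AbsolutelyContinuousOnInterval (fun t => g (f t)) a b := by
  rw [absolutelyContinuousOnInterval_iff] at hf ⊢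
  intro ε hε
  obtain ⟨δ, hδ, h⟩ := hf (ε / (K + 1)) (by positivity)
  refine ⟨δ, hδ, fun E hE hEδ => ?_⟩
  have h1 := h E hE hEδ
  calc ∑ i ∈ Finset.range E.1, dist (g (f (E.2 i).1)) (g (f (E.2 i).2))
      ≤ ∑ i ∈ Finset.range E.1, K * dist (f (E.2 i).1) (f (E.2 i).2) := by
        refine Finset.sum_le_sum fun i hi => ?_
        exact hg.dist_le_mul _ (hs (hE.1 i hi).1) _ (hs (hE.1 i hi).2)
    _ = K * ∑ i ∈ Finset.range E.1, dist (f (E.2 i).1) (f (E.2 i).2) := by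
        rw [Finset.mul_sum]
    _ ≤ K * (ε / (K + 1)) := by gcongr
    _ < (K + 1) * (ε / (K + 1)) := by gcongr; linarith
    _ = ε := by field_simp

lemma AbsolutelyContinuousOnInterval.locallyLipschitz_comp {X Y : Type*} [SeminormedAddCommGroup X]
    [PseudoMetricSpace Y] {f : ℝ → X} {g : X → Y} {a b : ℝ}
    (hf : AbsolutelyContinuousOnInterval f a b) (hg : LocallyLipschitz g) :
    AbsolutelyContinuousOnInterval (fun t => g (f t)) a b := by
  have hfc : ContinuousOn f (uIcc a b) := hf.continuousOn
  have hc : IsCompact (f '' uIcc a b) := isCompact_uIcc.image_of_continuousOn hfc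
  obtain ⟨K, hK⟩ := LocallyLipschitzOn.exists_lipschitzOnWith_of_compact hc
    hg.locallyLipschitzOn
  exact hf.lipschitzOnWith_comp hK (mapsTo_image _ _)

lemma AbsolutelyContinuousOnInterval.sub_le_of_ae_deriv_le {g : ℝ → ℝ} {a b R : ℝ} (hab : a ≤ b)
    (hg : AbsolutelyContinuousOnInterval g a b) (h : ∀ᵐ t, t ∈ Ioo a b → deriv g t ≤ R) :
    g b - g a ≤ (b - a) * R := by
  rw [← hg.integral_deriv_eq_sub]
  calc ∫ t in a..b, deriv g t ≤ ∫ _ in a..b, R := by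
        refine intervalIntegral.integral_mono_ae_restrict hab hg.intervalIntegrable_deriv
          intervalIntegrable_const ?_
        rw [EventuallyLE, ← restrict_Ioo_eq_restrict_Icc, ae_restrict_iff' measurableSet_Ioo]
        exact h
    _ = (b - a) * R := by simp

/-! ### Derivatives of Lipschitz functions along curves -/

section Lipschitz

variable {E : Type*} [NormedAddCommGroup E] [InnerProductSpace ℝ E] [FiniteDimensional ℝ E]
  [MeasurableSpace E] [BorelSpace E]

lemma LipschitzOnWith.ae_hasGradientAt {g : E → ℝ} {B : Set E} {K : NNReal} (hB : IsOpen B)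
    (hg : LipschitzOnWith K g B) : ∀ᵐ z : E, z ∈ B → HasGradientAt g (gradient g z) z := by
  filter_upwards [hg.ae_differentiableWithinAt_of_mem (μ := volume)] with z hz hzB
  exact ((hz hzB).differentiableAt (hB.mem_nhds hzB)).hasGradientAt

/-- Fubini: each translate of a null set is null, so almost every line in direction `v` meets it in
a null set of times. -/
lemma ae_ae_add_smul {P : E → Prop} (hP : ∀ᵐ z : E, P z) (v : E) :
    ∀ᵐ z : E, ∀ᵐ t : ℝ, P (z + t • v) := by
  -- `P` need not be measurable; the exchange of quantifiers is done on a measurable null hull.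
  set S := toMeasurable volume {z : E | ¬ P z} with hS
  have hS0 : volume S = 0 := by rw [hS, measure_toMeasurable]; exact hP
  have hSm : MeasurableSet S := measurableSet_toMeasurable _ _
  have h1 : ∀ᵐ t : ℝ, ∀ᵐ z : E, z + t • v ∉ S := by
    refine Eventually.of_forall fun t => ?_
    have : ∀ᵐ z : E, z ∉ S := measure_eq_zero_iff_ae_notMem.1 hS0
    exact (measurePreserving_add_right volume (t • v)).quasiMeasurePreserving.ae this
  have h2 : ∀ᵐ z : E, ∀ᵐ t : ℝ, z + t • v ∉ S := by
    refine (Measure.ae_ae_comm (p := fun (z : E) (t : ℝ) => z + t • v ∉ S) ?_).2 h1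
    have hm : Measurable (fun q : E × ℝ => q.1 + q.2 • v) := by fun_prop
    exact hm hSm.compl
  filter_upwards [h2] with z hz
  filter_upwards [hz] with t ht
  by_contra hn
  exact ht (subset_toMeasurable _ _ hn)

/-- On almost every segment in direction `v` the gradient bound holds at almost every point and can
be integrated. The integrated inequality involves no gradient, so continuity extends it to every
segment, even one inside the exceptional set. -/
lemma sub_le_of_ae_inner_gradient_le {g : E → ℝ} {y₀ : E} {r : ℝ} {K : NNReal}
    (hg : LipschitzOnWith K g (Metric.ball y₀ r)) {v : E} {R : ℝ}
    (h : ∀ᵐ z : E, z ∈ Metric.ball y₀ r → inner ℝ (gradient g z) v ≤ R)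
    {y : E} (hy : y ∈ Metric.ball y₀ r) {s : ℝ} (hs : 0 ≤ s) (hys : y + s • v ∈ Metric.ball y₀ r) :
    g (y + s • v) - g y ≤ s * R := by
  set B := Metric.ball y₀ r
  have hB : IsOpen B := Metric.isOpen_ball
  have key : ∀ᵐ z : E, z ∈ B → z + s • v ∈ B → g (z + s • v) - g z ≤ s * R := by
    filter_upwards [ae_ae_add_smul (h.and (hg.ae_hasGradientAt hB)) v] with z hz hzB hzsB
    have hseg : ∀ t ∈ Icc 0 s, z + t • v ∈ B := by
      intro t ht
      rcases hs.eq_or_lt with rfl | hs'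
      · obtain rfl : t = 0 := le_antisymm ht.2 ht.1
        simpa using hzB
      · have hconv : Convex ℝ B := convex_ball _ _
        have := hconv.add_smul_mem hzB hzsB (t := t / s)
          ⟨div_nonneg ht.1 hs, (div_le_one hs').2 ht.2⟩
        rwa [smul_smul, div_mul_cancel₀ _ hs'.ne'] at this
    have hac : AbsolutelyContinuousOnInterval (fun t : ℝ => g (z + t • v)) 0 s := by
      have h1 : AbsolutelyContinuousOnInterval (fun t : ℝ => z + t • v) 0 s :=
        (ContDiff.contDiffOn (by fun_prop)).absolutelyContinuousOnInterval
      refine h1.lipschitzOnWith_comp hg ?_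
      rw [uIcc_of_le hs]
      exact hseg
    have := hac.sub_le_of_ae_deriv_le (R := R) hs ?_
    · simpa using this
    · filter_upwards [hz] with t ht hts
      have hzt := hseg t (Ioo_subset_Icc_self hts)
      have hd : HasDerivAt (fun t : ℝ => z + t • v) v t := by
        simpa using ((hasDerivAt_id t).smul_const v).const_add z
      have h2 := ((ht.2 hzt).hasFDerivAt).comp_hasDerivAt t hd
      have h3 : deriv (fun t : ℝ => g (z + t • v)) t = inner ℝ (gradient g (z + t • v)) v := by
        have := h2.deriv
        simpa [Function.comp_def] using this
      rw [h3]
      exact ht.1 hzt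
  -- A failure at `y` would persist on a neighbourhood, which meets the dense set where the
  -- inequality is known.
  by_contra hcon
  push Not at hcon
  have hc1 : ContinuousAt g y := hg.continuousOn.continuousAt (hB.mem_nhds hy)
  have hc2 : ContinuousAt (fun z => g (z + s • v)) y :=
    ContinuousAt.comp (f := fun z => z + s • v) (hg.continuousOn.continuousAt (hB.mem_nhds hys))
      (by fun_prop)
  have e1 : ∀ᶠ z in 𝓝 y, s * R < g (z + s • v) - g z :=
    (hc2.sub hc1).eventually_const_lt hcon
  have e2 : ∀ᶠ z in 𝓝 y, z ∈ B := hB.mem_nhds hy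
  have e3 : ∀ᶠ z in 𝓝 y, z + s • v ∈ B :=
    ((by fun_prop : ContinuousAt (fun z => z + s • v) y)).preimage_mem_nhds (hB.mem_nhds hys)
  obtain ⟨U, hU, hUo, hyU⟩ := eventually_nhds_iff.1 (e1.and (e2.and e3))
  obtain ⟨z, hzU, hz⟩ := (Measure.dense_of_ae key).inter_open_nonempty U hUo ⟨y, hyU⟩
  obtain ⟨h1, h2, h3⟩ := hU z hzU
  exact absurd (hz h2 h3) (not_le.2 h1)

/-- The derivative of a Lipschitz function along a curve is bounded by the essential upper bound
of its gradients near the current point, in the direction of the curve. -/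
lemma hasDerivAt_comp_le_of_ae_inner_gradient_le {g : E → ℝ} {y : ℝ → E} {v : E} {t d R r : ℝ}
    {K : NNReal} (hr : 0 < r) (hg : LipschitzOnWith K g (Metric.ball (y t) r))
    (hd : HasDerivAt (fun s => g (y s)) d t) (hy : HasDerivAt y v t)
    (h : ∀ᵐ z : E, z ∈ Metric.ball (y t) r → inner ℝ (gradient g z) v ≤ R) : d ≤ R := by
  refine le_of_forall_pos_le_add fun η hη => ?_
  have hK : (0 : ℝ) < K + 1 := by positivity
  have hball : ∀ᶠ s in 𝓝 t, y s ∈ Metric.ball (y t) r :=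
    hy.continuousAt (Metric.ball_mem_nhds _ hr)
  have hlin : ∀ᶠ s in 𝓝 t, y t + (s - t) • v ∈ Metric.ball (y t) r := by
    have hc : ContinuousAt (fun s : ℝ => y t + (s - t) • v) t := by fun_prop
    refine hc ?_
    simpa using Metric.ball_mem_nhds (y t) hr
  -- Replacing the curve by its tangent changes `g` by at most `K` times this; `K + 1` avoids
  -- division by zero.
  have ho : ∀ᶠ s in 𝓝 t, ‖y s - y t - (s - t) • v‖ ≤ η / (K + 1) * ‖s - t‖ :=
    (hasDerivAt_iff_isLittleO.1 hy).def (by positivity)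
  have hslope : Tendsto (slope (fun s => g (y s)) t) (𝓝[>] t) (𝓝 d) :=
    (hasDerivAt_iff_tendsto_slope.1 hd).mono_left (nhdsWithin_mono _ fun s hs => ne_of_gt hs)
  refine le_of_tendsto hslope ?_
  filter_upwards [nhdsWithin_le_nhds hball, nhdsWithin_le_nhds hlin, nhdsWithin_le_nhds ho,
    self_mem_nhdsWithin] with s h1 h2 h3 (h4 : t < s)
  have hst : 0 < s - t := sub_pos.2 h4
  have a1 := sub_le_of_ae_inner_gradient_le hg h (Metric.mem_ball_self hr) hst.le h2
  have a2 := hg.dist_le_mul _ h1 _ h2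
  rw [Real.dist_eq, dist_eq_norm, ← sub_sub] at a2
  have a3 := (le_abs_self _).trans a2
  rw [Real.norm_of_nonneg hst.le] at h3
  have a4 : (K : ℝ) * ‖y s - y t - (s - t) • v‖ ≤ (s - t) * η := by
    calc (K : ℝ) * ‖y s - y t - (s - t) • v‖ ≤ (K + 1) * (η / (K + 1) * (s - t)) := by
          gcongr; linarith
      _ = (s - t) * η := by field_simp
  rw [slope_def_field, div_le_iff₀ hst]
  nlinarith

/-- Perturbed-direction version: the gradient bound is known in the direction of a continuous
vector field `F` with a continuous right-hand side `R`, on an open neighbourhood of the point. -/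
lemma hasDerivAt_comp_le_add_mul_norm_sub {g : E → ℝ} {y : ℝ → E} {v : E} {t d : ℝ}
    {K : NNReal} {O : Set E} (hO : IsOpen O) (hyO : y t ∈ O) (hg : LipschitzOnWith K g O)
    (hd : HasDerivAt (fun s => g (y s)) d t) (hy : HasDerivAt y v t) {F : E → E} {R : E → ℝ}
    (hF : ContinuousAt F (y t)) (hR : ContinuousAt R (y t))
    (h : ∀ᵐ z : E, z ∈ O → inner ℝ (gradient g z) (F z) ≤ R z) :
    d ≤ R (y t) + K * ‖v - F (y t)‖ := by
  refine le_of_forall_pos_le_add fun η hη => ?_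
  have hc : ContinuousAt (fun z => R z + K * ‖v - F z‖) (y t) := by fun_prop
  have hev : ∀ᶠ z in 𝓝 (y t), z ∈ O ∧ R z + K * ‖v - F z‖ < R (y t) + K * ‖v - F (y t)‖ + η :=
    (hO.eventually_mem hyO).and (hc.eventually_lt_const (by linarith))
  obtain ⟨r, hr, hball⟩ := Metric.eventually_nhds_iff_ball.1 hev
  refine hasDerivAt_comp_le_of_ae_inner_gradient_le hr (hg.mono fun z hz => (hball z hz).1) hd hy ?_
  filter_upwards [h, hg.ae_hasGradientAt hO] with z hz hzg hzB
  obtain ⟨hzO, hzR⟩ := hball z hzB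
  have hnorm : ‖gradient g z‖ ≤ K := by
    have := (hzg hzO).hasFDerivAt.le_of_lipschitzOn (hO.mem_nhds hzO) hg
    rwa [LinearIsometryEquiv.norm_map] at this
  calc inner ℝ (gradient g z) v
      = inner ℝ (gradient g z) (F z) + inner ℝ (gradient g z) (v - F z) := by
        rw [← inner_add_right]; congr 1; abel
    _ ≤ R z + K * ‖v - F z‖ := by
        refine add_le_add (hz hzO) ((real_inner_le_norm _ _).trans ?_)
        gcongr
    _ ≤ _ := hzR.le

end Lipschitz

/-! ### The Riccati equation behind the sampling bound -/

lemma Tmax_pos {γ Λ : ℝ} (hγ : 0 < γ) (hΛ : 0 < Λ) : 0 < Tmax γ Λ := by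
  have hq : 0 < γ / Λ := div_pos hγ hΛ
  unfold Tmax
  dsimp only
  split_ifs with h1 h2
  · have h3 : 1 < γ / Λ := (one_lt_div hΛ).2 h1
    have hr : 0 < √|(γ / Λ) ^ 2 - 1| := by
      apply Real.sqrt_pos.2; apply abs_pos.2; nlinarith
    have := Real.arctan_pos.2 hr
    positivity
  · positivity
  · have h3 : γ / Λ < 1 := (div_lt_one hΛ).2 (lt_of_le_of_ne (not_lt.1 h1) h2)
    have hr : 0 < √|(γ / Λ) ^ 2 - 1| := by
      apply Real.sqrt_pos.2; apply abs_pos.2; nlinarith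
    have hr1 : √|(γ / Λ) ^ 2 - 1| < 1 := by
      rw [Real.sqrt_lt' one_pos, abs_of_neg (by nlinarith)]; nlinarith
    have := Real.artanh_pos ⟨hr, hr1⟩
    positivity

/-- The linear system behind the Riccati equation. `Tmax γ Λ` is the first zero of `C - Λ S`; the
three cases are the trigonometric, affine and hyperbolic solutions, with frequency `Λ r`. -/
lemma exists_cos_sin_pair {γ Λ T : ℝ} (hγ : 0 < γ) (hΛ : 0 < Λ) (hT : T < Tmax γ Λ) :
    ∃ S C : ℝ → ℝ, (∀ s, HasDerivAt S (C s) s) ∧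
      (∀ s, HasDerivAt C ((Λ ^ 2 - γ ^ 2) * S s) s) ∧
      ∀ s ∈ Icc 0 T, 0 ≤ S s ∧ 0 < C s - Λ * S s := by
  unfold Tmax at hT
  dsimp only at hT
  set r := √|(γ / Λ) ^ 2 - 1| with hr
  have hq : 0 < γ / Λ := div_pos hγ hΛ
  have hqΛ : γ / Λ * Λ = γ := div_mul_cancel₀ _ hΛ.ne'
  split_ifs at hT with h1 h2
  · have h3 : 1 < γ / Λ := (one_lt_div hΛ).2 h1
    have hr2 : r ^ 2 = (γ / Λ) ^ 2 - 1 := by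
      rw [hr, Real.sq_sqrt (abs_nonneg _), abs_of_nonneg (by nlinarith)]
    have hr0 : 0 < r := Real.sqrt_pos.2 (abs_pos.2 (by nlinarith))
    have hω : 0 < Λ * r := by positivity
    have hω2 : (Λ * r) ^ 2 = γ ^ 2 - Λ ^ 2 := by rw [mul_pow, hr2]; field_simp
    refine ⟨fun s => Real.sin (Λ * r * s) / (Λ * r), fun s => Real.cos (Λ * r * s), fun s => ?_,
      fun s => ?_, fun s hs => ?_⟩
    · have h := (((hasDerivAt_id s).const_mul (Λ * r)).sin).div_const (Λ * r)
      refine h.congr_deriv ?_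
      simp only [id]; field_simp
    · have h := ((hasDerivAt_id s).const_mul (Λ * r)).cos
      refine h.congr_deriv ?_
      simp only [id]
      rw [← neg_sub (γ ^ 2), ← hω2]; field_simp
    · have hθ : Λ * r * s < Real.arctan r := by
        have : s < 1 / (Λ * r) * Real.arctan r := hs.2.trans_lt hT
        rw [one_div_mul_eq_div, lt_div_iff₀ hω] at this
        linarith
      have hθ0 : 0 ≤ Λ * r * s := mul_nonneg hω.le hs.1
      have hθ1 : Λ * r * s < Real.pi / 2 := hθ.trans (Real.arctan_lt_pi_div_two r)
      have hcos : 0 < Real.cos (Λ * r * s) :=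
        Real.cos_pos_of_mem_Ioo ⟨by linarith [Real.pi_pos], hθ1⟩
      have htan : Real.tan (Λ * r * s) < r := by
        have := Real.tan_lt_tan_of_lt_of_lt_pi_div_two (by linarith [Real.pi_pos])
          (Real.arctan_lt_pi_div_two r) hθ
        rwa [Real.tan_arctan] at this
      rw [Real.tan_eq_sin_div_cos, div_lt_iff₀ hcos] at htan
      refine ⟨div_nonneg (Real.sin_nonneg_of_nonneg_of_le_pi hθ0 (by linarith [Real.pi_pos])) hω.le,
        ?_⟩
      have : Λ * (Real.sin (Λ * r * s) / (Λ * r)) = Real.sin (Λ * r * s) / r := by field_simp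
      dsimp only
      rw [this, sub_pos, div_lt_iff₀ hr0]
      linarith
  · subst h2
    refine ⟨fun s => s, fun _ => 1, fun s => hasDerivAt_id s, fun s => ?_,
      fun s hs => ⟨hs.1, ?_⟩⟩
    · simpa using hasDerivAt_const s (1 : ℝ)
    · have : s < 1 / γ := hs.2.trans_lt hT
      rw [lt_div_iff₀ hγ] at this
      linarith
  · have h3 : γ / Λ < 1 := (div_lt_one hΛ).2 (lt_of_le_of_ne (not_lt.1 h1) h2)
    have hr2 : r ^ 2 = 1 - (γ / Λ) ^ 2 := by
      rw [hr, Real.sq_sqrt (abs_nonneg _), abs_of_neg (by nlinarith)]; ring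
    have hr0 : 0 < r := Real.sqrt_pos.2 (abs_pos.2 (by nlinarith))
    have hr1 : r < 1 := by nlinarith
    have hω : 0 < Λ * r := by positivity
    have hω2 : (Λ * r) ^ 2 = Λ ^ 2 - γ ^ 2 := by rw [mul_pow, hr2]; field_simp
    refine ⟨fun s => Real.sinh (Λ * r * s) / (Λ * r), fun s => Real.cosh (Λ * r * s), fun s => ?_,
      fun s => ?_, fun s hs => ?_⟩
    · have h := (((hasDerivAt_id s).const_mul (Λ * r)).sinh).div_const (Λ * r)
      refine h.congr_deriv ?_
      simp only [id]; field_simp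
    · have h := ((hasDerivAt_id s).const_mul (Λ * r)).cosh
      refine h.congr_deriv ?_
      simp only [id]
      rw [← hω2]; field_simp
    · have hθ : Λ * r * s < Real.artanh r := by
        have : s < 1 / (Λ * r) * Real.artanh r := hs.2.trans_lt hT
        rw [one_div_mul_eq_div, lt_div_iff₀ hω] at this
        linarith
      have hθ0 : 0 ≤ Λ * r * s := mul_nonneg hω.le hs.1
      have hcosh := Real.cosh_pos (Λ * r * s)
      have htanh : Real.tanh (Λ * r * s) < r := by
        by_contra hcon
        have := (Real.artanh_le_artanh_iff ⟨by linarith, hr1⟩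
          ⟨Real.neg_one_lt_tanh _, Real.tanh_lt_one _⟩).2 (not_lt.1 hcon)
        rw [Real.artanh_tanh] at this
        linarith
      rw [Real.tanh_eq_sinh_div_cosh, div_lt_iff₀ hcosh] at htanh
      refine ⟨div_nonneg (Real.sinh_nonneg_iff.2 hθ0) hω.le, ?_⟩
      have : Λ * (Real.sinh (Λ * r * s) / (Λ * r)) = Real.sinh (Λ * r * s) / r := by field_simp
      dsimp only
      rw [this, sub_pos, div_lt_iff₀ hr0]
      linarith

/-- For `T < Tmax γ Λ`, the equation `φ' = -2Λφ - γ(φ² + 1)` has a nonnegative solution on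
`[0, T]`. -/
lemma exists_riccati_solution {γ Λ T : ℝ} (hγ : 0 < γ) (hΛ : 0 < Λ) (hT : T < Tmax γ Λ) :
    ∃ φ : ℝ → ℝ, ∀ t ∈ Icc 0 T, 0 ≤ φ t ∧
      HasDerivAt φ (-(2 * Λ * φ t) - γ * (φ t ^ 2 + 1)) t := by
  obtain ⟨S, C, hS, hC, hpos⟩ := exists_cos_sin_pair hγ hΛ hT
  -- Solved backwards from the terminal value `φ T = 0`, which keeps `φ` nonnegative on the whole
  -- interval.
  refine ⟨fun t => γ * S (T - t) / (C (T - t) - Λ * S (T - t)), fun t ht => ?_⟩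
  have hmem : T - t ∈ Icc 0 T := ⟨by linarith [ht.2], by linarith [ht.1]⟩
  obtain ⟨h0, h1⟩ := hpos _ hmem
  refine ⟨by positivity, ?_⟩
  have hs : HasDerivAt (fun t => T - t) (-1) t := by
    simpa using (hasDerivAt_id t).const_sub T
  have hS' : HasDerivAt (fun t => S (T - t)) (C (T - t) * -1) t := (hS (T - t)).comp t hs
  have hC' : HasDerivAt (fun t => C (T - t)) ((Λ ^ 2 - γ ^ 2) * S (T - t) * -1) t :=
    (hC (T - t)).comp t hs
  refine ((hS'.const_mul γ).div (hC'.sub (hS'.const_mul Λ)) h1.ne').congr_deriv ?_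
  simp only [Pi.sub_apply]
  generalize S (T - t) = a at *
  generalize C (T - t) = b at *
  have h3 : b - Λ * a ≠ 0 := h1.ne'
  field_simp
  ring

/-! ### Decay of the Lyapunov function between two sampling instants -/

lemma absolutelyContinuousOnInterval_of_hasDerivAt {φ φ' : ℝ → ℝ} {a b : ℝ}
    (h : ∀ t ∈ uIcc a b, HasDerivAt φ (φ' t) t) (hc : ContinuousOn φ' (uIcc a b)) :
    AbsolutelyContinuousOnInterval φ a b := by
  obtain ⟨M, hM⟩ := isCompact_uIcc.exists_bound_of_continuousOn hc
  have hM0 : 0 ≤ M := (norm_nonneg _).trans (hM a left_mem_uIcc)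
  exact (Convex.lipschitzOnWith_of_nnnorm_hasDerivWithin_le (C := ⟨M, hM0⟩) (convex_uIcc a b)
    (fun t ht => (h t ht).hasDerivWithinAt) fun t ht => hM t ht).absolutelyContinuousOnInterval

/-- This is `U' ≤ -εU + A + K` for `U = v + γφW²`. The `-γ` in `φ'` cancels `γ²W²`, the `-γφ²`
completes the square `-(h - γφW)²`, and `-2Λφ` dominates the growth terms `2L + ε`. -/
lemma lyapunov_derivative_nonpos {ε v h γ W A K κ φ Λ L dV dW K₁ K₂ : ℝ} (hγ : 0 < γ)
    (hφ : 0 ≤ φ) (hW : 0 ≤ W) (hΛ : L + ε / 2 ≤ Λ)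
    (hdV : dV ≤ -ε * v - h ^ 2 + γ ^ 2 * W ^ 2 + A + K₁ * κ)
    (hdW : dW ≤ L * W + h + K₂ * κ) (hK : (K₁ + 2 * γ * φ * W * K₂) * κ ≤ K) :
    ε * v + ε * (γ * φ * W ^ 2) - (A + K) + (dV + (γ * (-(2 * Λ * φ) - γ * (φ ^ 2 + 1)) * W ^ 2 +
      γ * φ * (2 * W * dW))) ≤ 0 := by
  have h1 : γ * φ * (2 * W * dW) ≤ γ * φ * (2 * W * (L * W + h + K₂ * κ)) := by gcongr
  have h2 : 0 ≤ γ * φ * W ^ 2 * (2 * Λ - 2 * L - ε) :=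
    mul_nonneg (by positivity) (by linarith)
  nlinarith [sq_nonneg (h - γ * φ * W)]

section Flow

variable {np nc nw : ℕ} {f : PCVec np nc → PCVec np nc → Vec nw → PCVec np nc}
  {wbar : ℝ} {V : PCVec np nc → ℝ} {αw : ℝ → ℝ} {c ε γ L : ℝ}

/-- Estimate along a translate `x + p` of the flow that stays in the open sublevel set. -/
lemma LocalHybridLyapunov.translate_bound
    (hL : LocalHybridLyapunov f wbar V αw c ε γ L)
    (hf : Continuous (fun q : PCVec np nc × PCVec np nc × Vec nw => f q.1 q.2.1 q.2.2))
    (hε : ε ≠ 0) {A : ℝ} (hA : ∀ w : Vec nw, ‖w‖ ≤ wbar → αw ‖w‖ ≤ A)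
    {Λ : ℝ} (hΛL : L + ε / 2 ≤ Λ) (hΛ : 0 < Λ) {a b : ℝ} (hab : a ≤ b) (hT : b - a < Tmax γ Λ)
    {x e : ℝ → PCVec np nc} {w : ℝ → Vec nw}
    (hx : AbsolutelyContinuousOnInterval x a b) (he : AbsolutelyContinuousOnInterval e a b)
    (hder : ∀ᵐ t, t ∈ Icc a b → ‖w t‖ ≤ wbar ∧ HasDerivAt x (f (x t) (e t) (w t)) t ∧
      HasDerivAt e (-(f (x t) (e t) (w t))) t)
    (hxe : ∀ t ∈ Icc a b, x t + e t = x a) {κ : ℝ} (hκ : 0 < κ) :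
    ∃ ρ > 0, ∀ p, ‖p‖ < ρ → V (x a + p) < c → ∀ b' ∈ Icc a b,
      (∀ t ∈ Ico a b', V (x t + p) < c) →
      V (x b' + p) ≤ Real.exp (-ε * (b' - a)) * (V (x a + p) - (A + κ) / ε) + (A + κ) / ε := by
  obtain ⟨-, hγ, -, -, hV, -, -, W, H, hW, hW0, ⟨α₁, α₂, -, hα₂, hWα⟩, hH, -, hdW, hdV⟩ := hL
  obtain ⟨φ, hφ⟩ := exists_riccati_solution hγ hΛ hT
  have huIcc : uIcc a b = Icc a b := uIcc_of_le hab
  have hea : e a = 0 := by simpa using hxe a ⟨le_rfl, hab⟩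
  have hWea : W (e a) = 0 := by
    refine le_antisymm ?_ (hW0 _)
    rw [hea]
    have := (hWα 0).2
    rwa [norm_zero, hα₂.1.2.2] at this
  -- uniform bounds
  obtain ⟨R₁, hR₁⟩ := hx.exists_bound
  obtain ⟨R₂, hR₂⟩ := he.exists_bound
  rw [huIcc] at hR₁ hR₂
  obtain ⟨K₁, hK₁⟩ := LocallyLipschitzOn.exists_lipschitzOnWith_of_compact
    (isCompact_closedBall (0 : PCVec np nc) (R₁ + 1)) hV.locallyLipschitzOn
  obtain ⟨K₂, hK₂⟩ := LocallyLipschitzOn.exists_lipschitzOnWith_of_compact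
    (isCompact_closedBall (0 : PCVec np nc) (R₂ + 1)) hW.locallyLipschitzOn
  have hmaps : MapsTo (fun t => t - a) (Icc a b) (Icc 0 (b - a)) := fun t ht =>
    ⟨by linarith [ht.1], by linarith [ht.2]⟩
  have hφc : ContinuousOn (fun t => φ (t - a)) (Icc a b) := fun t ht =>
    (ContinuousAt.comp (f := fun t => t - a) (hφ _ (hmaps ht)).2.continuousAt
      (by fun_prop)).continuousWithinAt
  obtain ⟨M₁, hM₁⟩ := isCompact_Icc.exists_bound_of_continuousOn hφc
  have hec : ContinuousOn e (Icc a b) := huIcc ▸ he.continuousOn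
  obtain ⟨M₂, hM₂⟩ := isCompact_Icc.exists_bound_of_continuousOn
    (hW.continuous.comp_continuousOn hec)
  have hM₁0 : 0 ≤ M₁ := (norm_nonneg _).trans (hM₁ a ⟨le_rfl, hab⟩)
  have hM₂0 : 0 ≤ M₂ := (norm_nonneg _).trans (hM₂ a ⟨le_rfl, hab⟩)
  -- Bounds how strongly an error in the vector field enters `U'`; an error `κ / M` then costs at
  -- most `κ`.
  set M : ℝ := K₁ + 2 * γ * M₁ * M₂ * K₂ + 1 with hM
  have hMpos : 0 < M := by positivity
  have hcomp : IsCompact (Metric.closedBall (0 : PCVec np nc) (R₁ + 1) ×ˢ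
      (Metric.closedBall (0 : PCVec np nc) (R₂ + 1) ×ˢ Metric.closedBall (0 : Vec nw) wbar)) :=
    (isCompact_closedBall _ _).prod ((isCompact_closedBall _ _).prod (isCompact_closedBall _ _))
  have huc := hcomp.uniformContinuousOn_of_continuous hf.continuousOn
  obtain ⟨ρ, hρ, hfρ⟩ := Metric.uniformContinuousOn_iff.1 huc (κ / M) (by positivity)
  refine ⟨min ρ 1, by positivity, fun p hp hVp b' hb' hlt => ?_⟩
  have hpρ : ‖p‖ < ρ := hp.trans_le (min_le_left _ _)
  have hp1 : ‖p‖ < 1 := hp.trans_le (min_le_right _ _)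
  have hsub : Icc a b' ⊆ Icc a b := Icc_subset_Icc_right hb'.2
  have huIcc' : uIcc a b' = Icc a b' := uIcc_of_le hb'.1
  have hsubu : uIcc a b' ⊆ uIcc a b := by rw [huIcc, huIcc']; exact hsub
  have hx' := hx.mono hsubu
  have he' := he.mono hsubu
  set B := A + κ with hB
  -- absolute continuity of the comparison function
  have acV : AbsolutelyContinuousOnInterval (fun t => V (x t + p)) a b' := by
    refine hx'.locallyLipschitz_comp (g := fun z => V (z + p)) ?_
    exact hV.comp (ContDiff.locallyLipschitz (𝕂 := ℝ) (f := fun z : PCVec np nc => z + p)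
      (by fun_prop))
  have acW : AbsolutelyContinuousOnInterval (fun t => W (e t)) a b' :=
    he'.locallyLipschitz_comp hW
  have hφd : ∀ t ∈ Icc a b, HasDerivAt (fun t => φ (t - a))
      (-(2 * Λ * φ (t - a)) - γ * (φ (t - a) ^ 2 + 1)) t := fun t ht =>
    (hφ _ (hmaps ht)).2.comp_sub_const t a
  have acφ : AbsolutelyContinuousOnInterval (fun t => φ (t - a)) a b' := by
    refine absolutelyContinuousOnInterval_of_hasDerivAt
      (φ' := fun t => -(2 * Λ * φ (t - a)) - γ * (φ (t - a) ^ 2 + 1))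
      (fun t ht => hφd t (by rw [huIcc'] at ht; exact hsub ht)) ?_
    rw [huIcc']
    have := hφc.mono hsub
    exact ((continuousOn_const.mul this).neg).sub
      (continuousOn_const.mul ((this.pow 2).add continuousOn_const))
  have acE : AbsolutelyContinuousOnInterval (fun t => Real.exp (ε * (t - a))) a b' :=
    (ContDiff.contDiffOn (by fun_prop)).absolutelyContinuousOnInterval
  have acC : AbsolutelyContinuousOnInterval (fun _ : ℝ => B / ε) a b' :=
    (ContDiff.contDiffOn (by fun_prop)).absolutelyContinuousOnInterval
  -- With the integrating factor, the differential inequality says that this function is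
  -- nonincreasing.
  have acG : AbsolutelyContinuousOnInterval (fun t => Real.exp (ε * (t - a)) *
      (V (x t + p) + γ * φ (t - a) * W (e t) ^ 2 - B / ε)) a b' := by
    have := acE.mul ((acV.add ((acφ.const_mul γ).mul (acW.mul acW))).sub acC)
    convert this using 1
    funext t
    simp only [Pi.mul_apply, Pi.add_apply, Pi.sub_apply]
    ring
  have hdG : ∀ᵐ t, t ∈ Ioo a b' → deriv (fun t => Real.exp (ε * (t - a)) *
      (V (x t + p) + γ * φ (t - a) * W (e t) ^ 2 - B / ε)) t ≤ 0 := by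
    filter_upwards [hder, acV.ae_differentiableAt, acW.ae_differentiableAt] with t h1 h2 h3 ht
    have htI : t ∈ Icc a b := hsub (Ioo_subset_Icc_self ht)
    have htu : t ∈ uIcc a b' := by rw [huIcc']; exact Ioo_subset_Icc_self ht
    obtain ⟨hwt, hxd, hed⟩ := h1 htI
    have hVd := (h2 htu).hasDerivAt
    have hWd := (h3 htu).hasDerivAt
    set dV := deriv (fun t => V (x t + p)) t
    set dW := deriv (fun t => W (e t)) t
    have hyt : V (x t + p) < c := hlt t ⟨ht.1.le, ht.2⟩
    -- The error `e` is not translated, so the translated sampled state stays at `x a + p`.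
    have hyet : V (x t + p + e t) < c := by
      rwa [add_right_comm, hxe t htI]
    have hxn := hR₁ t htI
    have hen := hR₂ t htI
    have hyn : ‖x t + p‖ < R₁ + 1 := (norm_add_le _ _).trans_lt (by linarith)
    have hnear : ‖f (x t) (e t) (w t) - f (x t + p) (e t) (w t)‖ ≤ κ / M := by
      rw [← dist_eq_norm]
      refine (hfρ (x t, e t, w t) ?_ (x t + p, e t, w t) ?_ ?_).le
      · simp only [mem_prod, mem_closedBall_zero_iff]
        exact ⟨by linarith, by linarith, hwt⟩
      · simp only [mem_prod, mem_closedBall_zero_iff]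
        exact ⟨hyn.le, by linarith, hwt⟩
      · simpa [Prod.dist_eq, dist_eq_norm] using hpρ
    have hVc : Continuous V := hV.continuous
    have hHz : Continuous fun z => H z (e t) (w t) :=
      hH.comp_continuous (f := fun z => (z, e t, w t)) (by fun_prop) fun _ => hwt
    have hHe : Continuous fun e' => H (x t + p) e' (w t) :=
      hH.comp_continuous (f := fun e' => (x t + p, e', w t)) (by fun_prop) fun _ => hwt
    have hfz : Continuous fun z => f z (e t) (w t) :=
      hf.comp (g := fun q : PCVec np nc × PCVec np nc × Vec nw => f q.1 q.2.1 q.2.2)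
        (f := fun z => (z, e t, w t)) (by fun_prop)
    have hfe : Continuous fun e' => -(f (x t + p) e' (w t)) :=
      (hf.comp (g := fun q : PCVec np nc × PCVec np nc × Vec nw => f q.1 q.2.1 q.2.2)
        (f := fun e' => (x t + p, e', w t)) (by fun_prop)).neg
    have bV : dV ≤ (-ε * V (x t + p) - H (x t + p) (e t) (w t) ^ 2 + γ ^ 2 * W (e t) ^ 2 +
        αw ‖w t‖) + K₁ * ‖f (x t) (e t) (w t) - f (x t + p) (e t) (w t)‖ := by
      refine hasDerivAt_comp_le_add_mul_norm_sub (g := V) (y := fun s => x s + p)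
        (O := {z | V z < c} ∩ {z | V (z + e t) < c} ∩ Metric.ball 0 (R₁ + 1))
        (F := fun z => f z (e t) (w t))
        (R := fun z => -ε * V z - H z (e t) (w t) ^ 2 + γ ^ 2 * W (e t) ^ 2 + αw ‖w t‖)
        ?_ ⟨⟨hyt, hyet⟩, by simpa using hyn⟩ (hK₁.mono ?_) hVd (hxd.add_const p)
        hfz.continuousAt ?_ ?_
      · exact ((isOpen_lt hVc continuous_const).inter
          (isOpen_lt (hVc.comp (continuous_id.add continuous_const)) continuous_const)).inter
          Metric.isOpen_ball
      · exact fun z hz => Metric.ball_subset_closedBall hz.2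
      · exact Continuous.continuousAt (by fun_prop)
      · filter_upwards [hdV (e t) (w t) hwt] with z hz hzO
        exact hz hzO.1.1.le hzO.1.2.le
    have bW : dW ≤ (L * W (e t) + H (x t + p) (e t) (w t)) +
        K₂ * ‖-(f (x t) (e t) (w t)) - -(f (x t + p) (e t) (w t))‖ := by
      have hWc : Continuous W := hW.continuous
      refine hasDerivAt_comp_le_add_mul_norm_sub (g := W) (y := e)
        (O := {z | V (x t + p + z) < c} ∩ Metric.ball 0 (R₂ + 1))
        (F := fun z => -(f (x t + p) z (w t)))
        (R := fun z => L * W z + H (x t + p) z (w t))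
        ?_ ⟨hyet, ?_⟩ (hK₂.mono ?_) hWd hed hfe.continuousAt ?_ ?_
      · exact (isOpen_lt (hVc.comp (continuous_const.add continuous_id)) continuous_const).inter
          Metric.isOpen_ball
      · rw [mem_ball_zero_iff]; linarith
      · exact fun z hz => Metric.ball_subset_closedBall hz.2
      · exact Continuous.continuousAt (by fun_prop)
      · filter_upwards [hdW (x t + p) (w t) hyt.le hwt] with z hz hzO
        exact hz hzO.1.le
    rw [neg_sub_neg, norm_sub_rev] at bW
    have bV' : dV ≤ -ε * V (x t + p) - H (x t + p) (e t) (w t) ^ 2 + γ ^ 2 * W (e t) ^ 2 + A +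
        K₁ * (κ / M) := by
      have := hA _ hwt
      have : K₁ * ‖f (x t) (e t) (w t) - f (x t + p) (e t) (w t)‖ ≤ K₁ * (κ / M) := by gcongr
      linarith
    have bW' : dW ≤ L * W (e t) + H (x t + p) (e t) (w t) + K₂ * (κ / M) := by
      refine bW.trans ?_
      gcongr
    have hφt : 0 ≤ φ (t - a) := (hφ _ (hmaps htI)).1
    have hφM : φ (t - a) ≤ M₁ := (le_abs_self _).trans (hM₁ t htI)
    have hWM : W (e t) ≤ M₂ := (le_abs_self _).trans (hM₂ t htI)
    have hWt := hW0 (e t)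
    have hKM : ((K₁ : ℝ) + 2 * γ * φ (t - a) * W (e t) * K₂) * (κ / M) ≤ κ := by
      calc ((K₁ : ℝ) + 2 * γ * φ (t - a) * W (e t) * K₂) * (κ / M)
          ≤ (K₁ + 2 * γ * M₁ * M₂ * K₂) * (κ / M) := by gcongr
        _ ≤ M * (κ / M) := by gcongr; linarith
        _ = κ := by field_simp
    have hlyap := lyapunov_derivative_nonpos hγ hφt hWt hΛL bV' bW' hKM
    have hExp : HasDerivAt (fun t => Real.exp (ε * (t - a))) (Real.exp (ε * (t - a)) * ε) t := by
      simpa using (((hasDerivAt_id t).sub_const a).const_mul ε).exp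
    have hG := hExp.mul ((hVd.add (((hφd t htI).const_mul γ).mul (hWd.pow 2))).sub_const (B / ε))
    have : deriv (fun t => Real.exp (ε * (t - a)) *
      (V (x t + p) + γ * φ (t - a) * W (e t) ^ 2 - B / ε)) t = _ := hG.deriv
    rw [this]
    refine (le_of_eq ?_).trans (mul_nonpos_of_nonneg_of_nonpos (Real.exp_pos (ε * (t - a))).le hlyap)
    simp only [Pi.mul_apply, Pi.add_apply, Pi.pow_apply, hB]
    field_simp
    push_cast
    ring
  have hG := acG.sub_le_of_ae_deriv_le hb'.1 hdG
  rw [mul_zero, sub_nonpos, hWea] at hG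
  simp only [sub_self, mul_zero, Real.exp_zero, one_mul, ne_eq, OfNat.ofNat_ne_zero,
    not_false_eq_true, zero_pow, add_zero] at hG
  have hφb : 0 ≤ φ (b' - a) := (hφ _ (hmaps hb')).1
  have hU : 0 ≤ γ * φ (b' - a) * W (e b') ^ 2 := by positivity
  have hexp : Real.exp (-ε * (b' - a)) * Real.exp (ε * (b' - a)) = 1 := by
    rw [← Real.exp_add]; simp
  have h5 := mul_le_mul_of_nonneg_left hG (Real.exp_pos (-ε * (b' - a))).le
  rw [← mul_assoc, hexp, one_mul] at h5
  linarith

end Flow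

section Flow

variable {np nc nw : ℕ} {f : PCVec np nc → PCVec np nc → Vec nw → PCVec np nc}
  {wbar : ℝ} {V : PCVec np nc → ℝ} {αw : ℝ → ℝ} {c ε γ L : ℝ}

/-- Along the flow after a sampling instant, `V` satisfies the comparison bound, provided that
slightly perturbed comparison bounds stay below the level `c`. -/
lemma LocalHybridLyapunov.flow_bound
    (hL : LocalHybridLyapunov f wbar V αw c ε γ L)
    (hf : Continuous (fun q : PCVec np nc × PCVec np nc × Vec nw => f q.1 q.2.1 q.2.2))
    (hε : ε ≠ 0) {A : ℝ} (hA : ∀ w : Vec nw, ‖w‖ ≤ wbar → αw ‖w‖ ≤ A)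
    {Λ : ℝ} (hΛL : L + ε / 2 ≤ Λ) (hΛ : 0 < Λ) {a b : ℝ} (hab : a ≤ b) (hT : b - a < Tmax γ Λ)
    {x e : ℝ → PCVec np nc} {w : ℝ → Vec nw}
    (hx : AbsolutelyContinuousOnInterval x a b) (he : AbsolutelyContinuousOnInterval e a b)
    (hder : ∀ᵐ t, t ∈ Icc a b → ‖w t‖ ≤ wbar ∧ HasDerivAt x (f (x t) (e t) (w t)) t ∧
      HasDerivAt e (-(f (x t) (e t) (w t))) t)
    (hxe : ∀ t ∈ Icc a b, x t + e t = x a) (hclos : x a ∈ closure {y | V y < c})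
    (hsafe : ∃ κ₀ > 0, ∃ v₀ > V (x a), ∀ κ, 0 < κ → κ < κ₀ → ∀ v, 0 ≤ v → v < c → v < v₀ →
      ∀ s ∈ Icc 0 (b - a), Real.exp (-ε * s) * (v - (A + κ) / ε) + (A + κ) / ε < c) :
    V (x b) ≤ Real.exp (-ε * (b - a)) * (V (x a) - A / ε) + A / ε := by
  obtain ⟨κ₀, hκ₀, v₀, hv₀, hsafe⟩ := hsafe
  have hVc : Continuous V := hL.2.2.2.2.1.continuous
  have hV0 : ∀ x, 0 ≤ V x := hL.2.2.2.2.2.1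
  have hxc : ContinuousOn x (Icc a b) := by
    have := hx.continuousOn
    rwa [uIcc_of_le hab] at this
  have hκ : ∀ κ, 0 < κ → κ < κ₀ →
      V (x b) ≤ Real.exp (-ε * (b - a)) * (V (x a) - (A + κ) / ε) + (A + κ) / ε := by
    intro κ hκ hκκ₀
    obtain ⟨ρ, hρ, hp⟩ := hL.translate_bound hf hε hA hΛL hΛ hab hT hx he hder hxe hκ
    -- If the bound fails at `b`, it fails for all nearby translates, and `hclos` provides one
    -- starting in `{V < c}`.
    by_contra! hcon
    have e1 : ∀ᶠ y in 𝓝 (x a), ‖y - x a‖ < ρ := by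
      have : Tendsto (fun y => ‖y - x a‖) (𝓝 (x a)) (𝓝 0) := by
        have h : Continuous fun y => ‖y - x a‖ := by fun_prop
        simpa using h.tendsto (x a)
      exact this.eventually_lt_const hρ
    have e2 : ∀ᶠ y in 𝓝 (x a), V y < v₀ := hVc.continuousAt.eventually_lt_const hv₀
    have e3 : ∀ᶠ y in 𝓝 (x a), Real.exp (-ε * (b - a)) * (V y - (A + κ) / ε) + (A + κ) / ε <
        V (x b + (y - x a)) := by
      refine ContinuousAt.eventually_lt (by fun_prop) (by fun_prop) ?_
      simpa using hcon
    obtain ⟨y, ⟨hy1, hy2, hy3⟩, hyc⟩ :=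
      (mem_closure_iff_frequently.1 hclos).and_eventually (e1.and (e2.and e3)) |>.exists
        |>.imp fun y h => And.symm h
    have hyc' : V (x a + (y - x a)) < c := by simpa using hyc
    have hpy := hp (y - x a) hy1 hyc'
    simp only [add_sub_cancel] at hpy
    -- At a first exit time `T` the comparison bound still applies, and `hsafe` puts it strictly
    -- below `c`.
    have hstay : ∀ t ∈ Icc a b, V (x t + (y - x a)) < c := by
      by_contra! hne
      have hyt : ContinuousOn (fun t => V (x t + (y - x a))) (Icc a b) :=
        hVc.comp_continuousOn (hxc.add continuousOn_const)
      have hcl : IsCompact {t ∈ Icc a b | c ≤ V (x t + (y - x a))} :=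
        isCompact_Icc.of_isClosed_subset
          (hyt.preimage_isClosed_of_isClosed isClosed_Icc isClosed_Ici) fun t ht => ht.1
      obtain ⟨T, ⟨hT1, hT2⟩, hTmin⟩ := hcl.exists_isLeast hne
      have h1 := hpy T hT1 fun t ht => by
        by_contra! h
        exact absurd (hTmin ⟨⟨ht.1, ht.2.le.trans hT1.2⟩, h⟩) (not_le.2 ht.2)
      have h2 := hsafe κ hκ hκκ₀ (V y) (hV0 y) hyc hy2 (T - a)
        ⟨by linarith [hT1.1], by linarith [hT1.2]⟩
      linarith
    have := hpy b ⟨hab, le_rfl⟩ fun t ht => hstay t (Ico_subset_Icc_self ht)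
    linarith
  have hlim : Tendsto (fun κ => Real.exp (-ε * (b - a)) * (V (x a) - (A + κ) / ε) + (A + κ) / ε)
      (𝓝[>] 0) (𝓝 (Real.exp (-ε * (b - a)) * (V (x a) - A / ε) + A / ε)) := by
    have h : Continuous fun κ =>
        Real.exp (-ε * (b - a)) * (V (x a) - (A + κ) / ε) + (A + κ) / ε := by fun_prop
    have := h.tendsto 0
    simp only [add_zero] at this
    exact this.mono_left nhdsWithin_le_nhds
  refine ge_of_tendsto hlim ?_
  filter_upwards [Ioo_mem_nhdsGT hκ₀] with κ h
  exact hκ κ h.1 h.2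

/-- The bound is a convex combination of `v` and `(A + κ) / ε`, both below `c`. -/
lemma exists_safe_of_pos (hε : 0 < ε) {A v₁ T : ℝ} (hAc : A / ε < c) :
    ∃ κ₀ > 0, ∃ v₀ > v₁, ∀ κ, 0 < κ → κ < κ₀ → ∀ v, 0 ≤ v → v < c → v < v₀ →
      ∀ s ∈ Icc 0 T, Real.exp (-ε * s) * (v - (A + κ) / ε) + (A + κ) / ε < c := by
  rw [div_lt_iff₀ hε] at hAc
  refine ⟨c * ε - A, by linarith, v₁ + 1, by linarith, fun κ _ hκ v _ hv _ s hs => ?_⟩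
  have hB : (A + κ) / ε < c := by rw [div_lt_iff₀ hε]; linarith
  have h0 := Real.exp_pos (-ε * s)
  have h1 : Real.exp (-ε * s) ≤ 1 := Real.exp_le_one_iff.2 (by nlinarith [hs.1])
  nlinarith [mul_pos h0 (sub_pos.2 hv), mul_nonneg (sub_nonneg.2 h1) (sub_pos.2 hB).le]

/-- For `ε < 0` the bound increases in `s`, `v` and `κ`, so the corner `(T, v₁ + δ, δ)` is the worst
case; a small `δ` preserves the strict inequality there. -/
lemma exists_safe_of_neg (hε : ε < 0) {A v₁ T : ℝ} (hA : 0 ≤ A)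
    (hc : Real.exp (-ε * T) * (v₁ - A / ε) + A / ε < c) {T' : ℝ} (hT' : T' ≤ T) :
    ∃ κ₀ > 0, ∃ v₀ > v₁, ∀ κ, 0 < κ → κ < κ₀ → ∀ v, 0 ≤ v → v < c → v < v₀ →
      ∀ s ∈ Icc 0 T', Real.exp (-ε * s) * (v - (A + κ) / ε) + (A + κ) / ε < c := by
  have hcont : Continuous fun δ : ℝ =>
      Real.exp (-ε * T) * (v₁ + δ - (A + δ) / ε) + (A + δ) / ε := by fun_prop
  have hev : ∀ᶠ δ in 𝓝[>] (0 : ℝ),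
      Real.exp (-ε * T) * (v₁ + δ - (A + δ) / ε) + (A + δ) / ε < c := by
    refine nhdsWithin_le_nhds (hcont.continuousAt.eventually_lt_const ?_)
    simpa using hc
  obtain ⟨δ, hδc, hδ⟩ := (hev.and self_mem_nhdsWithin).exists
  have hδ : 0 < δ := hδ
  refine ⟨δ, hδ, v₁ + δ, by linarith, fun κ hκ0 hκ v hv0 _ hv s hs => lt_of_le_of_lt ?_ hδc⟩
  have hE : Real.exp (-ε * s) ≤ Real.exp (-ε * T) :=
    Real.exp_le_exp.2 (by nlinarith [hs.1, hs.2])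
  have h1 : 1 ≤ Real.exp (-ε * s) := Real.one_le_exp (by nlinarith [hs.1])
  have hB : -((A + κ) / ε) ≤ -((A + δ) / ε) := by
    rw [← div_neg, ← div_neg]
    exact div_le_div_of_nonneg_right (by linarith) (by linarith)
  have hB0 : 0 ≤ -((A + κ) / ε) := by
    rw [← div_neg]; exact div_nonneg (by linarith) (by linarith)
  calc Real.exp (-ε * s) * (v - (A + κ) / ε) + (A + κ) / ε
      = Real.exp (-ε * s) * v + (Real.exp (-ε * s) - 1) * -((A + κ) / ε) := by ring
    _ ≤ Real.exp (-ε * T) * (v₁ + δ) + (Real.exp (-ε * T) - 1) * -((A + δ) / ε) := by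
        gcongr
        linarith
    _ = _ := by ring

end Flow

/-! ### The sampling algorithm -/

/-- The strict inequality in the last case matters: a selected candidate exceeds the positive
fall-back interval and so is not the value `0` given when `v > C`. -/
lemma foldl_max_spec {ι : Type*} (h : ι → ℝ) (xs : List ι) (b : ℝ) :
    b ≤ xs.foldl (fun hbar i => if hbar < h i then h i else hbar) b ∧
    (xs.foldl (fun hbar i => if hbar < h i then h i else hbar) b = b ∨
      ∃ i, xs.foldl (fun hbar i => if hbar < h i then h i else hbar) b = h i ∧
        b < xs.foldl (fun hbar i => if hbar < h i then h i else hbar) b) := by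
  induction xs generalizing b with
  | nil => simp
  | cons i xs ih =>
    simp only [List.foldl_cons]
    by_cases hb : b < h i
    · simp only [if_pos hb]
      obtain ⟨h1, h2⟩ := ih (h i)
      refine ⟨hb.le.trans h1, Or.inr ?_⟩
      rcases h2 with h2 | ⟨k, h2, h3⟩
      · exact ⟨i, h2, hb.trans_le h1⟩
      · exact ⟨k, h2, hb.trans_le h1⟩
    · simp only [if_neg hb]
      exact ih b

lemma algorithmInterval_spec {n p : ℕ} {δ εref A : ℝ} {c : Fin n → ℝ}
    {ε γ L : Fin n → Fin (p + 1) → ℝ} {v C : ℝ} (h : ∃ l, max v C ≤ c l) :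
    ∃ l, max v C ≤ c l ∧
      fallbackInterval δ (ε l 0) (γ l 0) (L l 0) ≤ algorithmInterval δ εref A c ε γ L v C ∧
      (algorithmInterval δ εref A c ε γ L v C = fallbackInterval δ (ε l 0) (γ l 0) (L l 0) ∨
        ∃ i, i ≠ 0 ∧ algorithmInterval δ εref A c ε γ L v C =
            candidateInterval δ εref A (ε l i) (γ l i) (L l i) v C ∧
          fallbackInterval δ (ε l 0) (γ l 0) (L l 0) <
            algorithmInterval δ εref A c ε γ L v C) := by
  classical
  obtain ⟨l₀, hl₀⟩ := h
  have hne : (Finset.univ.filter (fun l : Fin n => max v C ≤ c l)).Nonempty :=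
    ⟨l₀, by simpa using hl₀⟩
  unfold algorithmInterval
  rw [dif_pos hne]
  dsimp only
  set l := (Finset.univ.filter (fun l : Fin n => max v C ≤ c l)).min' hne with hl
  refine ⟨l, ?_, ?_⟩
  · exact (Finset.mem_filter.1 (Finset.min'_mem _ hne)).2
  · obtain ⟨h1, h2⟩ := foldl_max_spec
      (fun i : Fin p => candidateInterval δ εref A (ε l i.succ) (γ l i.succ) (L l i.succ) v C)
      (List.finRange p) (fallbackInterval δ (ε l 0) (γ l 0) (L l 0))
    refine ⟨h1, h2.imp_right ?_⟩
    rintro ⟨i, hi⟩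
    exact ⟨i.succ, Fin.succ_ne_zero i, hi⟩

lemma fallbackInterval_pos {δ ε γ L : ℝ} (hδ : 0 < δ) (hε : 0 < ε) (hγ : 0 < γ) (hL : 0 < L) :
    0 < fallbackInterval δ ε γ L :=
  mul_pos hδ (Tmax_pos hγ (by positivity))

lemma candidateInterval_spec {δ εref A ε γ L v C : ℝ} (hε : ε < 0) (hεref : 0 < εref)
    (hpos : 0 < candidateInterval δ εref A ε γ L v C) :
    v ≤ C ∧ candidateInterval δ εref A ε γ L v C ≤ δ * Tmax γ (max (L + ε / 2) (1 - δ)) ∧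
      (-ε + εref) * candidateInterval δ εref A ε γ L v C ≤
        Real.log (C - A / ε) - Real.log (v - A / ε) := by
  have h0 : 0 < -ε + εref := by linarith
  unfold candidateInterval at hpos ⊢
  dsimp only at hpos ⊢
  split_ifs at hpos ⊢ with h1
  · refine ⟨h1, min_le_left _ _, ?_⟩
    rw [mul_comm, ← le_div_iff₀ h0]
    exact min_le_right _ _
  · exact absurd hpos (lt_irrefl _)

/-- Growth of the comparison bound for a negative decay rate on an interval whose length respects
the logarithmic constraint of the algorithm. -/
lemma comparison_le_of_log_bound {A ε εref v C s : ℝ} (hA : 0 < A) (hε : ε < 0) (hv : 0 ≤ v)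
    (hC : 0 ≤ C) (hs : (-ε + εref) * s ≤ Real.log (C - A / ε) - Real.log (v - A / ε)) :
    Real.exp (-ε * s) * (v - A / ε) + A / ε ≤
      Real.exp (-εref * s) * C + (1 - Real.exp (-εref * s)) * (A / ε) := by
  have hAε : A / ε < 0 := div_neg_of_pos_of_neg hA hε
  have hC' : 0 < C - A / ε := by linarith
  have hv' : 0 < v - A / ε := by linarith
  have h1 : Real.exp ((-ε + εref) * s) * (v - A / ε) ≤ C - A / ε := by
    rw [← Real.log_div hC'.ne' hv'.ne'] at hs
    have := Real.exp_le_exp.2 hs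
    rwa [Real.exp_log (div_pos hC' hv'), le_div_iff₀ hv'] at this
  have h2 : Real.exp (-ε * s) = Real.exp (-εref * s) * Real.exp ((-ε + εref) * s) := by
    rw [← Real.exp_add]; congr 1; ring
  have h3 := mul_le_mul_of_nonneg_left h1 (Real.exp_pos (-εref * s)).le
  rw [← mul_assoc, ← h2] at h3
  linarith

/-! ### One sampling interval: invariance of `{V ≤ cmax}` and exponential decay. -/

section Step

variable {np nc nw n p : ℕ} {f : PCVec np nc → PCVec np nc → Vec nw → PCVec np nc}
  {wbar δ εref cw cmax μ : ℝ} {V : PCVec np nc → ℝ} {αw : ℝ → ℝ} {c : Fin n → ℝ}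
  {ε γ L : Fin n → Fin (p + 1) → ℝ}

/-- Over one sampling interval chosen by the algorithm, `V - c_w` decays exponentially relative to
the maximum of its initial value and `C - c_w`, and `V` stays below `c_max`. -/
lemma sampling_interval_decay
    (hf : Continuous (fun q : PCVec np nc × PCVec np nc × Vec nw => f q.1 q.2.1 q.2.2))
    (hwbar : 0 < wbar) (hδ₀ : 0 < δ) (hδ₁ : δ < 1) (hεref : 0 < εref)
    (hLyap : ∀ l i, LocalHybridLyapunov f wbar V αw (c l) (ε l i) (γ l i) (L l i))
    (hε_pos : ∀ l, 0 < ε l 0) (hε_neg : ∀ l i, i ≠ 0 → ε l i < 0)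
    (hcw : ∀ l, αw wbar / ε l 0 ≤ cw)
    (hcmax : ∃ l, cmax ≤ c l)
    (hstrict : ∀ l, cw ≤ c l → c l ≤ cmax → αw wbar / ε l 0 < c l)
    (hregular : ∀ l, cw ≤ c l → c l ≤ cmax → ∀ x, V x = c l → x ∈ closure {y | V y < c l})
    (hμ : ∀ l, μ ≤ ε l 0) (hμref : μ ≤ εref)
    {a b : ℝ} (hab : a ≤ b) {x e : ℝ → PCVec np nc} {w : ℝ → Vec nw}
    (hx : AbsolutelyContinuousOnInterval x a b) (he : AbsolutelyContinuousOnInterval e a b)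
    (hder : ∀ᵐ t, t ∈ Icc a b → ‖w t‖ ≤ wbar ∧ HasDerivAt x (f (x t) (e t) (w t)) t ∧
      HasDerivAt e (-(f (x t) (e t) (w t))) t)
    (hxe : ∀ t ∈ Icc a b, x t + e t = x a)
    {C : ℝ} (hcwC : cw ≤ C) (hCmax : C ≤ cmax) (hVmax : V (x a) ≤ cmax)
    (hba : b - a ≤ algorithmInterval δ εref (αw wbar) c ε γ L (V (x a)) C)
    {Q : ℝ} (hVQ : V (x a) - cw ≤ Q) (hCQ : C - cw ≤ Q) (hQ : 0 ≤ Q) :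
    V (x b) ≤ cmax ∧ V (x b) - cw ≤ Real.exp (-μ * (b - a)) * Q := by
  set s := b - a with hs
  have hs0 : 0 ≤ s := sub_nonneg.2 hab
  obtain ⟨l, hl, hfb, hΓ⟩ := algorithmInterval_spec (δ := δ) (εref := εref) (A := αw wbar)
    (c := c) (ε := ε) (γ := γ) (L := L) (v := V (x a)) (C := C)
    (hcmax.imp fun l h => (max_le hVmax hCmax).trans h)
  set Γ := algorithmInterval δ εref (αw wbar) c ε γ L (V (x a)) C
  obtain ⟨hVl, hCl⟩ := max_le_iff.1 hl
  have hα : ClassKInfty αw := (hLyap l 0).2.2.2.1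
  have hV0 : ∀ x, 0 ≤ V x := (hLyap l 0).2.2.2.2.2.1
  have hVc : Continuous V := (hLyap l 0).2.2.2.2.1.continuous
  have hA : ∀ w : Vec nw, ‖w‖ ≤ wbar → αw ‖w‖ ≤ αw wbar := fun w hw =>
    hα.1.2.1.monotoneOn (norm_nonneg _) (mem_Ici.2 hwbar.le) hw
  have hApos : 0 < αw wbar := by
    have := hα.1.2.1 (mem_Ici.2 le_rfl) (mem_Ici.2 hwbar.le) hwbar
    rwa [hα.1.2.2] at this
  have hcw0 : 0 ≤ cw := (div_pos hApos (hε_pos l)).le.trans (hcw l)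
  -- Only a sample exactly on the level set needs the regularity assumption.
  have hclos : x a ∈ closure {y | V y < c l} := by
    rcases hVl.lt_or_eq with h | h
    · exact subset_closure h
    · exact hregular l (hcwC.trans hCl) (h ▸ hVmax) _ h
  have hfbpos : 0 < fallbackInterval δ (ε l 0) (γ l 0) (L l 0) :=
    fallbackInterval_pos hδ₀ (hε_pos l) (hLyap l 0).2.1 (hLyap l 0).2.2.1
  rcases hΓ with hΓ | ⟨i, hi, hΓ, hΓfb⟩
  · have hAc : αw wbar / ε l 0 < c l := by
      rcases le_or_gt (c l) cmax with h | h
      · exact hstrict l (hcwC.trans hCl) h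
      · exact (hcw l).trans_lt ((hcwC.trans hCmax).trans_lt h)
    have hΛ : 0 < L l 0 + ε l 0 / 2 := by
      have := (hLyap l 0).2.2.1
      have := hε_pos l
      positivity
    have hTpos := Tmax_pos (hLyap l 0).2.1 hΛ
    have hT : b - a < Tmax (γ l 0) (L l 0 + ε l 0 / 2) := by
      rw [hΓ] at hba
      refine hba.trans_lt ?_
      unfold fallbackInterval
      nlinarith
    have key := (hLyap l 0).flow_bound hf (hε_pos l).ne' hA le_rfl hΛ hab hT hx he hder hxe hclos
      (exists_safe_of_pos (hε_pos l) hAc)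
    rw [← hs] at key
    have hE0 := Real.exp_pos (-ε l 0 * s)
    have hE1 : Real.exp (-ε l 0 * s) ≤ 1 := Real.exp_le_one_iff.2 (by nlinarith [hε_pos l])
    have hEμ : Real.exp (-ε l 0 * s) ≤ Real.exp (-μ * s) :=
      Real.exp_le_exp.2 (by nlinarith [hμ l])
    have hAcw := hcw l
    constructor
    · nlinarith
    · calc V (x b) - cw ≤ Real.exp (-ε l 0 * s) * (V (x a) - cw) := by nlinarith
        _ ≤ Real.exp (-ε l 0 * s) * Q := by gcongr
        _ ≤ _ := by gcongr
  · have hε := hε_neg l i hi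
    have hC0 : 0 ≤ C := hcw0.trans hcwC
    have hΓpos : 0 < Γ := hfbpos.trans hΓfb
    obtain ⟨-, hΓT, hlog⟩ := candidateInterval_spec (L := L l i) hε hεref (hΓ ▸ hΓpos)
    rw [← hΓ] at hΓT hlog
    set Λ := max (L l i + ε l i / 2) (1 - δ)
    have hΛ : 0 < Λ := lt_max_of_lt_right (by linarith)
    have hTpos := Tmax_pos (hLyap l i).2.1 hΛ
    have hT : b - a < Tmax (γ l i) Λ := (hba.trans hΓT).trans_lt (by nlinarith)
    have hAε : αw wbar / ε l i < 0 := div_neg_of_pos_of_neg hApos hε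
    have hcΓ := comparison_le_of_log_bound hApos hε (hV0 (x a)) hC0 hlog
    have hEΓ : Real.exp (-εref * Γ) < 1 := by
      rw [← Real.exp_zero]; exact Real.exp_lt_exp.2 (by linarith [mul_pos hεref hΓpos])
    -- Strict because `αw wbar / ε l i < 0` and `Γ > 0`, even when `C = c l`.
    have hsafeΓ : Real.exp (-ε l i * Γ) * (V (x a) - αw wbar / ε l i) + αw wbar / ε l i < c l := by
      have h1 := mul_neg_of_pos_of_neg (sub_pos.2 hEΓ) hAε
      linarith [mul_le_of_le_one_left hC0 hEΓ.le]
    have key := (hLyap l i).flow_bound hf hε.ne hA (le_max_left _ _) hΛ hab hT hx he hder hxe hclos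
      (exists_safe_of_neg hε hApos.le (T := Γ) hsafeΓ hba)
    rw [← hs] at key
    have hcs := comparison_le_of_log_bound (s := s) hApos hε (hV0 (x a)) hC0
      ((mul_le_mul_of_nonneg_left hba (by linarith)).trans hlog)
    have hE0 := Real.exp_pos (-εref * s)
    have hE1 : Real.exp (-εref * s) ≤ 1 :=
      Real.exp_le_one_iff.2 (by linarith [mul_nonneg hεref.le hs0])
    have hEμ : Real.exp (-εref * s) ≤ Real.exp (-μ * s) :=
      Real.exp_le_exp.2 (mul_le_mul_of_nonneg_right (neg_le_neg hμref) hs0)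
    have hVb : V (x b) ≤ Real.exp (-εref * s) * C := by
      linarith [mul_nonpos_of_nonneg_of_nonpos (sub_nonneg.2 hE1) hAε.le]
    constructor
    · linarith [mul_le_of_le_one_left hC0 hE1]
    · calc V (x b) - cw ≤ Real.exp (-εref * s) * (C - cw) := by
            linarith [mul_le_of_le_one_left hcw0 hE1]
        _ ≤ Real.exp (-εref * s) * Q := by gcongr
        _ ≤ _ := by gcongr

lemma firC_sub_le {m : ℕ} (hm : 1 < m) {x : PCVec np nc} {η : Vec (m - 1)} {Q : ℝ}
    (hV : V x - cw ≤ Q) (hη : ∀ k, η k - cw ≤ Q) (hQ : 0 ≤ Q) : firC m V cw cmax x η - cw ≤ Q := by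
  have hm0 : (0 : ℝ) < m := by exact_mod_cast (by omega : 0 < m)
  have hsum : ∑ k, η k ≤ (m - 1) * (cw + Q) := by
    calc ∑ k, η k ≤ ∑ _k : Fin (m - 1), (cw + Q) := Finset.sum_le_sum fun k _ => by linarith [hη k]
      _ = (m - 1) * (cw + Q) := by
        rw [Finset.sum_const, Finset.card_univ, Fintype.card_fin, nsmul_eq_mul,
          Nat.cast_sub hm.le, Nat.cast_one]
  have havg : 1 / (m : ℝ) * (V x + ∑ k, η k) ≤ cw + Q := by
    rw [one_div_mul_eq_div, div_le_iff₀ hm0]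
    linarith
  rw [sub_le_iff_le_add, add_comm]
  exact max_le ((min_le_left _ _).trans havg) (by linarith)

end Step

/-! ### Hybrid time domains -/

namespace IsHybridTimeDomain

variable {dom : Set (ℝ × ℕ)}

/-- The jump times are those of the truncation at `(T, J)`, hence the restriction to `s ≤ T` and `j
≤ J`. -/
lemma exists_times (h : IsHybridTimeDomain dom) {T : ℝ} {J : ℕ} (hTJ : (T, J) ∈ dom) :
    ∃ t : ℕ → ℝ, t 0 = 0 ∧ (∀ j ≤ J, t j ≤ t (j + 1)) ∧
      ∀ s j, s ≤ T → j ≤ J → ((s, j) ∈ dom ↔ t j ≤ s ∧ s ≤ t (j + 1)) := by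
  obtain ⟨J', t, h0, hmono, hD⟩ := h.2 _ hTJ
  have hJ : J < J' := by
    have hmem : (T, J) ∈ dom ∩ {q : ℝ × ℕ | 0 ≤ q.1 ∧ q.1 ≤ T ∧ q.2 ≤ J} :=
      ⟨hTJ, h.1 _ hTJ, le_rfl, le_rfl⟩
    rw [hD] at hmem
    exact hmem.1
  refine ⟨t, h0, fun j hj => hmono j (hj.trans_lt hJ), fun s j hs hj => ⟨fun hsj => ?_, fun hsj => ?_⟩⟩
  · have hmem : (s, j) ∈ dom ∩ {q : ℝ × ℕ | 0 ≤ q.1 ∧ q.1 ≤ T ∧ q.2 ≤ J} :=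
      ⟨hsj, h.1 _ hsj, hs, hj⟩
    rw [hD] at hmem
    exact hmem.2
  · have hmem : (s, j) ∈ {p : ℝ × ℕ | p.2 < J' ∧ t p.2 ≤ p.1 ∧ p.1 ≤ t (p.2 + 1)} :=
      ⟨hj.trans_lt hJ, hsj⟩
    rw [← hD] at hmem
    exact hmem.1

lemma zero_mem (h : IsHybridTimeDomain dom) {T : ℝ} {J : ℕ} (hTJ : (T, J) ∈ dom) :
    ((0 : ℝ), 0) ∈ dom := by
  obtain ⟨t, h0, hmono, hiff⟩ := h.exists_times hTJ
  have := hmono 0 (Nat.zero_le _)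
  rw [h0] at this
  exact (hiff 0 0 (h.1 _ hTJ) (Nat.zero_le _)).2 ⟨h0.le, this⟩

lemma exists_jump (h : IsHybridTimeDomain dom) {T : ℝ} {J : ℕ} (hTJ : (T, J + 1) ∈ dom) :
    ∃ s ≤ T, (s, J) ∈ dom ∧ (s, J + 1) ∈ dom := by
  obtain ⟨t, -, hmono, hiff⟩ := h.exists_times hTJ
  have hT := ((hiff T (J + 1) le_rfl le_rfl).1 hTJ).1
  exact ⟨t (J + 1), hT, (hiff _ J hT (Nat.le_succ J)).2 ⟨hmono J (Nat.le_succ J), le_rfl⟩,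
    (hiff _ (J + 1) hT le_rfl).2 ⟨le_rfl, hmono (J + 1) le_rfl⟩⟩

lemma jump_le (h : IsHybridTimeDomain dom) {s s' : ℝ} {j : ℕ} (h₁ : (s, j) ∈ dom)
    (h₂ : (s, j + 1) ∈ dom) (h₃ : (s', j + 1) ∈ dom) : s ≤ s' := by
  by_contra! hlt
  obtain ⟨t, -, -, hiff⟩ := h.exists_times h₂
  have h4 := ((hiff s j le_rfl (Nat.le_succ j)).1 h₁).2
  have h5 := ((hiff s' (j + 1) hlt.le le_rfl).1 h₃).1
  linarith

lemma Icc_mem (h : IsHybridTimeDomain dom) {a b r : ℝ} {j : ℕ} (ha : (a, j) ∈ dom)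
    (hb : (b, j) ∈ dom) (hr : r ∈ Icc a b) : (r, j) ∈ dom := by
  obtain ⟨t, -, -, hiff⟩ := h.exists_times hb
  have h4 := ((hiff a j (hr.1.trans hr.2) le_rfl).1 ha).1
  have h5 := ((hiff b j le_rfl le_rfl).1 hb).2
  exact (hiff r j hr.2 le_rfl).2 ⟨h4.trans hr.1, hr.2.trans h5⟩

end IsHybridTimeDomain

/-! ### Solutions of the self-triggered system -/

section STC

variable {np nc nη nw : ℕ} {f : PCVec np nc → PCVec np nc → Vec nw → PCVec np nc}
  {S : Vec nη → PCVec np nc → Vec nη} {Γ : PCVec np nc → Vec nη → ℝ}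
  {w : ℝ → Vec nw} {dom : Set (ℝ × ℕ)} {ξ : ℝ → ℕ → STCState np nc nη}

/-- Behaviour of the components of a solution during a flow. -/
lemma HybridSystem.IsSolution.stc_flow (hsol : (stcSystem f S Γ).IsSolution w dom ξ)
    {a b : ℝ} {j : ℕ} (hab : a ≤ b) (ha : (a, j) ∈ dom) (hb : (b, j) ∈ dom) :
    AbsolutelyContinuousOnInterval (fun t => (ξ t j).x) a b ∧
    AbsolutelyContinuousOnInterval (fun t => (ξ t j).e) a b ∧
    (∀ᵐ t, t ∈ Icc a b →
      HasDerivAt (fun t => (ξ t j).x) (f (ξ t j).x (ξ t j).e (w t)) t ∧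
      HasDerivAt (fun t => (ξ t j).e) (-(f (ξ t j).x (ξ t j).e (w t))) t) ∧
    (∀ t ∈ Icc a b, (ξ t j).x + (ξ t j).e = (ξ a j).x + (ξ a j).e) ∧
    (ξ b j).η = (ξ a j).η ∧ (ξ b j).τ = (ξ a j).τ + (b - a) ∧ (ξ b j).τmax = (ξ a j).τmax ∧
    (a < b → (ξ a j).τ + (b - a) ≤ (ξ a j).τmax) := by
  obtain ⟨-, ⟨hdom, hac⟩, hflow, -⟩ := hsol
  have huIcc : uIcc a b = Icc a b := uIcc_of_le hab
  have hac := hac j a b hab ha hb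
  have acx : AbsolutelyContinuousOnInterval (fun t => (ξ t j).x) a b :=
    hac.locallyLipschitz_comp (g := fun ξ : STCState np nc nη => ξ.1)
      (ContDiff.locallyLipschitz (𝕂 := ℝ) (by fun_prop))
  have ace : AbsolutelyContinuousOnInterval (fun t => (ξ t j).e) a b :=
    hac.locallyLipschitz_comp (g := fun ξ : STCState np nc nη => ξ.2.1)
      (ContDiff.locallyLipschitz (𝕂 := ℝ) (by fun_prop))
  have acη : AbsolutelyContinuousOnInterval (fun t => (ξ t j).η) a b :=
    hac.locallyLipschitz_comp (g := fun ξ : STCState np nc nη => ξ.2.2.1)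
      (ContDiff.locallyLipschitz (𝕂 := ℝ) (by fun_prop))
  have acτ : AbsolutelyContinuousOnInterval (fun t => (ξ t j).τ) a b :=
    hac.locallyLipschitz_comp (g := fun ξ : STCState np nc nη => ξ.2.2.2.1)
      (ContDiff.locallyLipschitz (𝕂 := ℝ) (by fun_prop))
  have acm : AbsolutelyContinuousOnInterval (fun t => (ξ t j).τmax) a b :=
    hac.locallyLipschitz_comp (g := fun ξ : STCState np nc nη => ξ.2.2.2.2)
      (ContDiff.locallyLipschitz (𝕂 := ℝ) (by fun_prop))
  have act : AbsolutelyContinuousOnInterval (fun t : ℝ => t) a b :=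
    (ContDiff.contDiffOn (by fun_prop)).absolutelyContinuousOnInterval
  have hd : ∀ᵐ t, t ∈ Icc a b → (ξ t j).τ ≤ (ξ t j).τmax ∧
      HasDerivAt (fun t => (ξ t j).x) (f (ξ t j).x (ξ t j).e (w t)) t ∧
      HasDerivAt (fun t => (ξ t j).e) (-(f (ξ t j).x (ξ t j).e (w t))) t ∧
      HasDerivAt (fun t => (ξ t j).η) 0 t ∧ HasDerivAt (fun t => (ξ t j).τ) 1 t ∧
      HasDerivAt (fun t => (ξ t j).τmax) 0 t := by
    filter_upwards [hflow j] with t ht htI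
    obtain ⟨hC, hD⟩ := ht (hdom.Icc_mem ha hb htI)
    have h2 := hD.snd
    have h3 := h2.snd
    have h4 := h3.snd
    exact ⟨hC, hD.fst, h2.fst, h3.fst, h4.fst, h4.snd⟩
  have hconst {F : Type} [NormedAddCommGroup F] [NormedSpace ℝ F] {g : ℝ → F}
      (hg : AbsolutelyContinuousOnInterval g a b)
      (hg' : ∀ᵐ t, t ∈ Icc a b → HasDerivAt g 0 t) : ∀ t ∈ Icc a b, g t = g a := by
    obtain ⟨C, hC⟩ := hg.const_of_ae_hasDerivAt_zero (by rwa [huIcc])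
    rw [huIcc] at hC
    intro t ht
    rw [hC t ht, hC a ⟨le_rfl, hab⟩]
  have hxe : ∀ t ∈ Icc a b, (ξ t j).x + (ξ t j).e = (ξ a j).x + (ξ a j).e := by
    refine hconst (acx.add ace) ?_
    filter_upwards [hd] with t ht htI
    obtain ⟨-, h1, h2, -⟩ := ht htI
    have h3 := h1.add h2
    rw [add_neg_cancel] at h3
    exact h3
  have hη : ∀ t ∈ Icc a b, (ξ t j).η = (ξ a j).η := by
    refine hconst acη ?_
    filter_upwards [hd] with t ht htI using (ht htI).2.2.2.1
  have hm : ∀ t ∈ Icc a b, (ξ t j).τmax = (ξ a j).τmax := by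
    refine hconst acm ?_
    filter_upwards [hd] with t ht htI using (ht htI).2.2.2.2.2
  have hτ : ∀ t ∈ Icc a b, (ξ t j).τ = (ξ a j).τ + (t - a) := by
    have : ∀ t ∈ Icc a b, (ξ t j).τ - t = (ξ a j).τ - a := by
      refine hconst (acτ.sub act) ?_
      filter_upwards [hd] with t ht htI
      have h3 := (ht htI).2.2.2.2.1.sub (hasDerivAt_id t)
      rw [sub_self] at h3
      exact h3
    intro t ht
    linarith [this t ht]
  have hbI : b ∈ Icc a b := ⟨hab, le_rfl⟩
  refine ⟨acx, ace, ?_, hxe, hη b hbI, hτ b hbI, hm b hbI, fun hlt => ?_⟩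
  · filter_upwards [hd] with t ht htI using ⟨(ht htI).2.1, (ht htI).2.2.1⟩
  · by_contra! hcon
    -- The flow set constraint is known only almost everywhere. A violation at `b` would fill the
    -- open interval from `max a r` to `b`, where some good time exists.
    set r := (ξ a j).τmax - (ξ a j).τ + a
    obtain ⟨t, htI, ht⟩ := (Measure.dense_of_ae hd).inter_open_nonempty (Ioo (max a r) b) isOpen_Ioo
      (nonempty_Ioo.2 (max_lt hlt (by linarith)))
    have h1 : a < t := (le_max_left _ _).trans_lt htI.1
    have h2 : r < t := (le_max_right _ _).trans_lt htI.1
    have htI' : t ∈ Icc a b := ⟨h1.le, htI.2.le⟩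
    have h3 := (ht htI').1
    rw [hτ t htI', hm t htI'] at h3
    linarith

/-- Before the first jump of an admissible solution no time passes. -/
lemma HybridSystem.IsSolution.stc_eq_zero_of_mem (hsol : (stcSystem f S Γ).IsSolution w dom ξ)
    (h0 : (ξ 0 0).τmax = (ξ 0 0).τ) {t : ℝ} (ht : (t, 0) ∈ dom) : t = 0 := by
  have hdom := hsol.2.1.1
  have ht0 : 0 ≤ t := hdom.1 _ ht
  by_contra hne
  have hpos : 0 < t := lt_of_le_of_ne ht0 (Ne.symm hne)
  have := (hsol.stc_flow ht0 (hdom.zero_mem ht) ht).2.2.2.2.2.2.2 hpos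
  linarith

/-- Behaviour of a solution between a jump at time `s` and a later time before the next jump. -/
lemma HybridSystem.IsSolution.stc_after_jump (hsol : (stcSystem f S Γ).IsSolution w dom ξ)
    {s t : ℝ} {j : ℕ} (hs : (s, j) ∈ dom) (hs' : (s, j + 1) ∈ dom) (ht : (t, j + 1) ∈ dom)
    (hΓ : 0 ≤ Γ (ξ s j).x (ξ s j).η) :
    (ξ s (j + 1)).x = (ξ s j).x ∧
    (∀ r ∈ Icc s t, (ξ r (j + 1)).x + (ξ r (j + 1)).e = (ξ s (j + 1)).x) ∧
    (ξ t (j + 1)).η = S (ξ s j).η (ξ s j).x ∧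
    t - s ≤ Γ (ξ s j).x (ξ s j).η ∧
    ((t, j + 2) ∈ dom → t - s = Γ (ξ s j).x (ξ s j).η) := by
  have hdom := hsol.2.1.1
  have hst := hdom.jump_le hs hs' ht
  obtain ⟨-, -, -, hxe, hη, hτ, hm, hle⟩ := hsol.stc_flow hst hs' ht
  have hj := (hsol.2.2.2 s j hs hs').2
  have jx : (ξ s (j + 1)).x = (ξ s j).x := by rw [hj]; rfl
  have je : (ξ s (j + 1)).e = 0 := by rw [hj]; rfl
  have jη : (ξ s (j + 1)).η = S (ξ s j).η (ξ s j).x := by rw [hj]; rfl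
  have jτ : (ξ s (j + 1)).τ = 0 := by rw [hj]; rfl
  have jm : (ξ s (j + 1)).τmax = Γ (ξ s j).x (ξ s j).η := by rw [hj]; rfl
  refine ⟨jx, fun r hr => ?_, hη.trans jη, ?_, fun ht' => ?_⟩
  · rw [hxe r hr, je, add_zero]
  -- With no flow after the jump the flow set gives no constraint, and `hΓ` is needed.
  · rcases hst.eq_or_lt with rfl | hlt
    · simpa using hΓ
    · have := hle hlt
      rwa [jτ, jm, zero_add] at this
  · have h1 : (ξ t (j + 1)).τ = (ξ t (j + 1)).τmax := (hsol.2.2.2 t (j + 1) ht ht').1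
    rwa [hτ, hm, jτ, jm, zero_add] at h1

end STC

/-! ### An exponential comparison function -/

lemma classKL_mul_exp {K μ : ℝ} (hK : 0 < K) (hμ : 0 < μ) :
    ClassKL (fun q s => q * (K * Real.exp (-μ * s))) := by
  refine ⟨by fun_prop, fun t _ => ⟨by fun_prop, ?_, by simp⟩, fun q hq => ⟨?_, ?_⟩⟩
  · intro a _ b _ hab
    have : 0 < K * Real.exp (-μ * t) := by positivity
    exact mul_lt_mul_of_pos_right hab this
  · intro a _ b _ hab
    have : Real.exp (-μ * b) ≤ Real.exp (-μ * a) := Real.exp_le_exp.2 (by nlinarith)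
    dsimp only
    gcongr
  · have h1 : Tendsto (fun s : ℝ => Real.exp (-μ * s)) atTop (𝓝 0) :=
      Real.tendsto_exp_atBot.comp (tendsto_id.const_mul_atTop_of_neg (neg_neg_of_pos hμ))
    simpa using (h1.const_mul K).const_mul q

/-- The shift `j - 1` accounts for the first jump, which happens at time `0` and brings no decay. -/
lemma classKLL_exp {μ ν : ℝ} (hμ : 0 < μ) (hν : 0 < ν) :
    ClassKLL (fun q t j => q * (Real.exp (-μ * t) * Real.exp (-ν * (j - 1)))) := by
  intro r _
  constructor
  · have : (fun q s : ℝ => q * (Real.exp (-μ * r) * Real.exp (-ν * (s - 1)))) =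
        fun q s => q * (Real.exp (-μ * r) * Real.exp ν * Real.exp (-ν * s)) := by
      funext q s
      rw [mul_assoc (Real.exp (-μ * r)), ← Real.exp_add ν]
      congr 3; ring
    rw [this]
    exact classKL_mul_exp (by positivity) hν
  · have : (fun q s : ℝ => q * (Real.exp (-μ * s) * Real.exp (-ν * (r - 1)))) =
        fun q s => q * (Real.exp (-ν * (r - 1)) * Real.exp (-μ * s)) := by
      funext q s; ring
    rw [this]
    exact classKL_mul_exp (by positivity) hμ

/-! ### Main result -/

/-- Discounting `y` rather than `y - cw` only helps, since `cw ≥ 0`. -/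
lemma firS_sub_le {np nc m : ℕ} {V : PCVec np nc → ℝ} {εref cw μ Q : ℝ}
    {Γ : PCVec np nc → Vec (m - 1) → ℝ} {η : Vec (m - 1)} {x : PCVec np nc}
    (hΓ : 0 ≤ Γ x η) (hμ : μ ≤ εref) (hεref : 0 ≤ εref) (hcw : 0 ≤ cw) (hQ : 0 ≤ Q)
    (hV : V x - cw ≤ Q) (hη : ∀ k, η k - cw ≤ Q) (k : Fin (m - 1)) :
    firS m V εref Γ η x k - cw ≤ Real.exp (-μ * Γ x η) * Q := by
  have hE0 := Real.exp_pos (-εref * Γ x η)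
  have hE1 : Real.exp (-εref * Γ x η) ≤ 1 :=
    Real.exp_le_one_iff.2 (by linarith [mul_nonneg hεref hΓ])
  have hEμ : Real.exp (-εref * Γ x η) ≤ Real.exp (-μ * Γ x η) :=
    Real.exp_le_exp.2 (mul_le_mul_of_nonneg_right (neg_le_neg hμ) hΓ)
  have hy : ∀ y, y - cw ≤ Q → Real.exp (-εref * Γ x η) * y - cw ≤ Real.exp (-μ * Γ x η) * Q := by
    intro y hy
    calc Real.exp (-εref * Γ x η) * y - cw ≤ Real.exp (-εref * Γ x η) * (y - cw) := by
          linarith [mul_le_of_le_one_left hcw hE1]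
      _ ≤ Real.exp (-εref * Γ x η) * Q := by gcongr
      _ ≤ _ := by gcongr
  unfold firS
  dsimp only
  split_ifs
  · exact hy _ (hη _)
  · exact hy _ hV

theorem theorem4 {np nc nu nw m n p : ℕ}
    (fp : Vec np → Vec nu → Vec nw → Vec np) (fc : Vec nc → Vec np → Vec nc)
    (gc : Vec nc → Vec np → Vec nu)
    (hf : Continuous (fun q : PCVec np nc × PCVec np nc × Vec nw =>
      closedLoop fp fc gc q.1 q.2.1 q.2.2))
    (hm : 1 < m) (wbar : ℝ) (hwbar : 0 < wbar)
    (δ : ℝ) (hδ₀ : 0 < δ) (hδ₁ : δ < 1) (εref : ℝ) (hεref : 0 < εref)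
    (V : PCVec np nc → ℝ) (αw : ℝ → ℝ)
    (c : Fin n → ℝ) (ε γ L : Fin n → Fin (p + 1) → ℝ)
    (hLyap : ∀ l i, LocalHybridLyapunov (closedLoop fp fc gc) wbar V αw (c l)
      (ε l i) (γ l i) (L l i))
    (hε_pos : ∀ l, 0 < ε l 0) (hε_neg : ∀ l i, i ≠ 0 → ε l i < 0)
    (cw cmax : ℝ) (hcw : ∀ l, αw wbar / ε l 0 ≤ cw) (hcw_cmax : cw ≤ cmax)
    (hcmax : ∃ l, cmax ≤ c l)
    (hstrict : ∀ l, cw ≤ c l → c l ≤ cmax → αw wbar / ε l 0 < c l)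
    (hregular : ∀ l, cw ≤ c l → c l ≤ cmax → ∀ x, V x = c l → x ∈ closure {y | V y < c l})
    (Γ : PCVec np nc → Vec (m - 1) → ℝ)
    (hΓ : ∀ x η, Γ x η =
      algorithmInterval δ εref (αw wbar) c ε γ L (V x) (firC m V cw cmax x η))
    (tmin : ℝ) (htmin : tmin = ⨅ l : Fin n, fallbackInterval δ (ε l 0) (γ l 0) (L l 0)) :
    0 < tmin ∧
    (∀ (w : ℝ → Vec nw) (dom : Set (ℝ × ℕ)) (ξ : ℝ → ℕ → STCState np nc (m - 1)),
      (∀ t, 0 ≤ t → ‖w t‖ ≤ wbar) →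
      (stcSystem (closedLoop fp fc gc) (firS m V εref Γ) Γ).IsSolution w dom ξ →
      IsAdmissibleInit V cmax (ξ 0 0) →
      InterSamplingAtLeast dom tmin) ∧
    IsRAS (stcSystem (closedLoop fp fc gc) (firS m V εref Γ) Γ) wbar V cw cmax := by
  set f := closedLoop fp fc gc
  obtain ⟨l₀, hl₀⟩ := hcmax
  have : Nonempty (Fin n) := ⟨l₀⟩
  have hfb : ∀ l, 0 < fallbackInterval δ (ε l 0) (γ l 0) (L l 0) := fun l =>
    fallbackInterval_pos hδ₀ (hε_pos l) (hLyap l 0).2.1 (hLyap l 0).2.2.1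
  have htmin_le : ∀ l, tmin ≤ fallbackInterval δ (ε l 0) (γ l 0) (L l 0) := fun l => by
    rw [htmin]; exact ciInf_le (Set.finite_range _).bddBelow l
  have htmin_pos : 0 < tmin := by
    obtain ⟨l, hl⟩ := exists_eq_ciInf_of_finite
      (f := fun l : Fin n => fallbackInterval δ (ε l 0) (γ l 0) (L l 0))
    rw [htmin, ← hl]
    exact hfb l
  obtain ⟨μ, hμpos, hμref, hμ⟩ : ∃ μ > 0, μ ≤ εref ∧ ∀ l, μ ≤ ε l 0 := by
    obtain ⟨l, hl⟩ := exists_eq_ciInf_of_finite (f := fun l : Fin n => ε l 0)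
    refine ⟨min εref (ε l 0), lt_min hεref (hε_pos l), min_le_left _ _, fun k => ?_⟩
    refine (min_le_right _ _).trans ?_
    rw [hl]
    exact ciInf_le (Set.finite_range fun l : Fin n => ε l 0).bddBelow k
  have hα : ClassKInfty αw := (hLyap l₀ 0).2.2.2.1
  have hcw0 : 0 ≤ cw := by
    have h1 := hα.1.2.1 (mem_Ici.2 le_rfl) (mem_Ici.2 hwbar.le) hwbar
    rw [hα.1.2.2] at h1
    exact (div_pos h1 (hε_pos l₀)).le.trans (hcw l₀)
  have hC_mem : ∀ x (η : Vec (m - 1)), cw ≤ firC m V cw cmax x η ∧ firC m V cw cmax x η ≤ cmax :=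
    fun x η => ⟨le_max_right _ _, max_le (min_le_right _ _) hcw_cmax⟩
  have hΓmin : ∀ x (η : Vec (m - 1)), V x ≤ cmax → tmin ≤ Γ x η := fun x η hx => by
    obtain ⟨l, -, hl, -⟩ := algorithmInterval_spec (δ := δ) (εref := εref) (A := αw wbar)
      (c := c) (ε := ε) (γ := γ) (L := L) (v := V x) (C := firC m V cw cmax x η)
      ⟨l₀, (max_le hx (hC_mem x η).2).trans hl₀⟩
    rw [hΓ]
    exact (htmin_le l).trans hl
  -- the invariant at the jump times, and its consequence on the following flow
  have main : ∀ (w : ℝ → Vec nw) (dom : Set (ℝ × ℕ)) (ξ : ℝ → ℕ → STCState np nc (m - 1)),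
      (∀ t, 0 ≤ t → ‖w t‖ ≤ wbar) → (stcSystem f (firS m V εref Γ) Γ).IsSolution w dom ξ →
      IsAdmissibleInit V cmax (ξ 0 0) → ∀ Q : ℝ, 0 ≤ Q → V (ξ 0 0).x - cw ≤ Q →
      (∀ k, (ξ 0 0).η k - cw ≤ Q) → ∀ (j : ℕ) (s : ℝ), (s, j) ∈ dom → (s, j + 1) ∈ dom →
      (V (ξ s j).x ≤ cmax ∧ j * tmin ≤ s) ∧
      ∀ t, (t, j + 1) ∈ dom → V (ξ t (j + 1)).x ≤ cmax ∧
        V (ξ t (j + 1)).x - cw ≤ Real.exp (-μ * t) * Q ∧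
        ((t, j + 2) ∈ dom → tmin ≤ t - s ∧
          ∀ k, (ξ t (j + 1)).η k - cw ≤ Real.exp (-μ * t) * Q) := by
    intro w dom ξ hw hsol hinit Q hQ hVQ hηQ
    have hdom := hsol.2.1.1
    have step : ∀ (j : ℕ) (s : ℝ), (s, j) ∈ dom → (s, j + 1) ∈ dom → V (ξ s j).x ≤ cmax →
        V (ξ s j).x - cw ≤ Real.exp (-μ * s) * Q →
        (∀ k, (ξ s j).η k - cw ≤ Real.exp (-μ * s) * Q) →
        ∀ t, (t, j + 1) ∈ dom → V (ξ t (j + 1)).x ≤ cmax ∧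
          V (ξ t (j + 1)).x - cw ≤ Real.exp (-μ * t) * Q ∧
          ((t, j + 2) ∈ dom → tmin ≤ t - s ∧
            ∀ k, (ξ t (j + 1)).η k - cw ≤ Real.exp (-μ * t) * Q) := by
      intro j s hs hs' hV hVs hηs t ht
      have hst := hdom.jump_le hs hs' ht
      have hs0 := hdom.1 _ hs
      have hΓs := hΓmin (ξ s j).x (ξ s j).η hV
      have hΓ0 : 0 ≤ Γ (ξ s j).x (ξ s j).η := htmin_pos.le.trans hΓs
      obtain ⟨acx, ace, hder, -⟩ := hsol.stc_flow hst hs' ht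
      obtain ⟨jx, hxe, hη, hle, heq⟩ := hsol.stc_after_jump hs hs' ht hΓ0
      have hQs : 0 ≤ Real.exp (-μ * s) * Q := by positivity
      have hexp : ∀ r, r = t - s → Real.exp (-μ * r) * (Real.exp (-μ * s) * Q) =
          Real.exp (-μ * t) * Q := by
        rintro r rfl
        rw [← mul_assoc, ← Real.exp_add]; congr 2; ring
      have hdecay := sampling_interval_decay hf hwbar hδ₀ hδ₁ hεref hLyap hε_pos hε_neg hcw
        ⟨l₀, hl₀⟩ hstrict hregular hμ hμref hst acx ace
        (by
          filter_upwards [hder] with r hr hrI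
          exact ⟨hw r (hs0.trans hrI.1), hr hrI⟩)
        hxe (C := firC m V cw cmax (ξ s j).x (ξ s j).η) (hC_mem _ _).1 (hC_mem _ _).2
        (by rw [jx]; exact hV) (by rw [jx, ← hΓ]; exact hle) (by rw [jx]; exact hVs)
        (firC_sub_le hm hVs hηs hQs) hQs
      rw [hexp _ rfl] at hdecay
      refine ⟨hdecay.1, hdecay.2, fun ht' => ?_⟩
      -- At the next jump the elapsed time equals `Γ`, so the discount built into `η` matches the
      -- decay over the interval.
      have hts := heq ht'
      refine ⟨hts ▸ hΓs, fun k => ?_⟩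
      rw [hη, ← hexp _ hts.symm]
      exact firS_sub_le hΓ0 hμref hεref.le hcw0 hQs hVs hηs k
    intro j
    induction j with
    | zero =>
      intro s hs hs'
      obtain rfl := hsol.stc_eq_zero_of_mem hinit.2.2 hs
      exact ⟨⟨hinit.1, by simp⟩,
        step 0 0 hs hs' hinit.1 (by simpa using hVQ) (by simpa using hηQ)⟩
    | succ j ih =>
      intro s hs hs'
      obtain ⟨r, hrs, hr, hr'⟩ := hdom.exists_jump hs
      obtain ⟨⟨-, hjr⟩, hflow⟩ := ih r hr hr'
      obtain ⟨h1, h2, h3⟩ := hflow s hs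
      obtain ⟨h4, h5⟩ := h3 hs'
      refine ⟨⟨h1, ?_⟩, step (j + 1) s hs hs' h1 h2 h5⟩
      push_cast
      linarith
  have hQ : ∀ ξ₀ : STCState np nc (m - 1),
      0 ≤ max (V ξ₀.x - cw) 0 + √(‖ξ₀.e‖ ^ 2 + ‖ξ₀.η‖ ^ 2) ∧
      V ξ₀.x - cw ≤ max (V ξ₀.x - cw) 0 + √(‖ξ₀.e‖ ^ 2 + ‖ξ₀.η‖ ^ 2) ∧
      ∀ k, ξ₀.η k - cw ≤ max (V ξ₀.x - cw) 0 + √(‖ξ₀.e‖ ^ 2 + ‖ξ₀.η‖ ^ 2) := by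
    intro ξ₀
    have h1 := le_max_left (V ξ₀.x - cw) 0
    have h2 := le_max_right (V ξ₀.x - cw) 0
    have h3 := Real.sqrt_nonneg (‖ξ₀.e‖ ^ 2 + ‖ξ₀.η‖ ^ 2)
    have h4 : ‖ξ₀.η‖ ≤ √(‖ξ₀.e‖ ^ 2 + ‖ξ₀.η‖ ^ 2) :=
      Real.le_sqrt_of_sq_le (by linarith [sq_nonneg ‖ξ₀.e‖])
    refine ⟨by linarith, by linarith, fun k => ?_⟩
    have h5 : ξ₀.η k ≤ ‖ξ₀.η‖ := (le_abs_self _).trans (PiLp.norm_apply_le ξ₀.η k)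
    linarith
  refine ⟨htmin_pos, ?_, ?_⟩
  · intro w dom ξ hw hsol hinit j t t' h1 h2 h3 h4
    obtain ⟨hQ0, hQV, hQη⟩ := hQ (ξ 0 0)
    exact (((main w dom ξ hw hsol hinit _ hQ0 hQV hQη j t h1 h2).2 t' h3).2.2 h4).1
  -- Half of the rate `μ` is kept for `t`; the other half is converted into decay in `j` through `t
  -- ≥ (j - 1) tmin`.
  · refine ⟨fun q t j => q * (Real.exp (-(μ / 2) * t) * Real.exp (-(μ / 2 * tmin) * (j - 1))),
      classKLL_exp (by positivity) (by positivity), ?_⟩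
    intro w dom ξ hw hsol hinit t j htj
    obtain ⟨hQ0, hQV, hQη⟩ := hQ (ξ 0 0)
    have hdom := hsol.2.1.1
    set Q := max (V (ξ 0 0).x - cw) 0 + √(‖(ξ 0 0).e‖ ^ 2 + ‖(ξ 0 0).η‖ ^ 2)
    rw [← sub_le_iff_le_add']
    dsimp only
    rw [mul_comm Q, ← Real.exp_add]
    cases j with
    | zero =>
      obtain rfl := hsol.stc_eq_zero_of_mem hinit.2.2 htj
      refine hQV.trans (le_mul_of_one_le_left hQ0 (Real.one_le_exp ?_))
      have : 0 < μ / 2 * tmin := by positivity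
      push_cast
      linarith
    | succ j =>
      obtain ⟨s, hst, hs, hs'⟩ := hdom.exists_jump htj
      obtain ⟨⟨-, hjs⟩, hflow⟩ := main w dom ξ hw hsol hinit _ hQ0 hQV hQη j s hs hs'
      refine (hflow t htj).2.1.trans (mul_le_mul_of_nonneg_right (Real.exp_le_exp.2 ?_) hQ0)
      push_cast
      have := mul_le_mul_of_nonneg_left (hjs.trans hst) (by positivity : 0 ≤ μ / 2)
      linarith
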